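/- **Definitions.** Let $N,n\ge 1$ be integers, $\delta\in(0,1]$ and $K\ge 1$. A set $\mathcal A=A_1\times\dots\times A_n\subset\mathbb Z^n$ is $(N,n,K,\delta)$-admissible if every $A_i\subset\mathbb Z$ is origin-symmetric; $A_i$ is an integer interval of cardinality at least $2N+1$ for every $i>\delta n$; $A_i$ is a union of two integer intervals of total cardinality at least $2N$ and $A_i\cap[-N,N]=\emptyset$ for every $i\le\delta n$; $|A_1|\cdots|A_n|\le (KN)^n$; and $\max A_i<nN$ for all $1\le i\le n$. A map $g:\mathbb Z\to\mathbb R$ is called $\eta$-Lipschitz if $|g(t)-g(t+1)|\le\eta$ for all $t\in\mathbb Z$. For $f:\mathbb Z\to\mathbb R$, $p\in(0,1)$ and independent random variables $X_1,\dots,X_n$, with $X_i$ uniformly distributed on $A_i$, let $f_{\mathcal A,p,n}$ be the random function $$f_{\mathcal A,p,n}(t)=\mathbb E_b\, f\Big(t+\sum_{j=1}^n b_jX_j\Big)=\sum_{v\in\{0,1\}^n}p^{\sum_j v_j}(1-p)^{n-\sum_j v_j}f(t+v_1X_1+\dots+v_nX_n),\qquad t\in\mathbb Z,$$ where $\mathbb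 E_b$ is the expectation over independent Bernoulli($p$) variables $b_1,\dots,b_n$, independent of the $X_i$. **Theorem.** For any $\delta\in(0,1]$, $p\in(0,1/2]$, $\varepsilon\in(0,p)$ and $K\ge 1$ there is a constant $L=L(\delta,\varepsilon,p,K)>0$ such that for every $M\ge 1$ there are $n_0=n_0(\delta,\varepsilon,p,K,M)\ge 1$ and $\eta=\eta(\delta,\varepsilon,p,K,M)\in(0,1]$ with the following property. Let $n\ge n_0$, let $N$ be an integer with $1\le N\le(1-p+\varepsilon)^{-n}$, let $\mathcal A\subset\mathbb Z^n$ be $(N,n,K,\delta)$-admissible, and let $f\in\ell_1(\mathbb Z)$ be non-negative with $\|f\|_1=1$ and such that $\log_2 f$ is real-valued (that is, $f>0$ everywhere) and $\eta$-Lipschitz. Then $$\mathbb P\big\{\|f_{\mathcal A,p,n}\|_\infty> L\,(N\sqrt n)^{-1}\big\}\le \exp(-Mn).$$ In particular $L$ does not depend on $M$. -/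

import Mathlib

open MeasureTheory ProbabilityTheory

namespace RandomAveraging

/-- `S` is an integer interval `{a, a + 1, …, b}`. -/
def IsIntegerInterval (S : Finset ℤ) : Prop :=
  ∃ a b : ℤ, S = Finset.Icc a b

/-- The factors `A₁, …, Aₙ` of an `(N, n, K, δ)`-admissible set `A₁ × ⋯ × Aₙ ⊆ ℤⁿ`.
The element `i : Fin n` stands for the index `i + 1 ∈ {1, …, n}`. -/
structure IsAdmissible (N n : ℕ) (K δ : ℝ) (A : Fin n → Finset ℤ) : Prop where
  /-- every factor is origin-symmetric -/
  symm : ∀ i, ∀ a ∈ A i, -a ∈ A i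
  /-- for indices `> δ n` the factor is an integer interval ... -/
  interval : ∀ i : Fin n, δ * n < ((i : ℕ) + 1 : ℝ) → IsIntegerInterval (A i)
  /-- ... of cardinality at least `2 N + 1` -/
  card_interval : ∀ i : Fin n, δ * n < ((i : ℕ) + 1 : ℝ) → 2 * N + 1 ≤ (A i).card
  /-- for indices `≤ δ n` the factor is a union of two integer intervals ... -/
  union : ∀ i : Fin n, ((i : ℕ) + 1 : ℝ) ≤ δ * n →
    ∃ I J : Finset ℤ, IsIntegerInterval I ∧ IsIntegerInterval J ∧ A i = I ∪ J
  /-- ... of total cardinality at least `2 N` ... -/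
  card_union : ∀ i : Fin n, ((i : ℕ) + 1 : ℝ) ≤ δ * n → 2 * N ≤ (A i).card
  /-- ... and does not meet `[-N, N]` -/
  disjoint : ∀ i : Fin n, ((i : ℕ) + 1 : ℝ) ≤ δ * n →
    Disjoint (A i) (Finset.Icc (-(N : ℤ)) (N : ℤ))
  /-- `|A₁| ⋯ |Aₙ| ≤ (K N) ^ n` -/
  card_prod : ((∏ i, (A i).card : ℕ) : ℝ) ≤ (K * N) ^ n
  /-- `max Aᵢ < n N` -/
  max_lt : ∀ i, ∀ a ∈ A i, a < (n : ℤ) * N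

/-- A map `g : ℤ → ℝ` is `L`-Lipschitz if `|g t - g (t + 1)| ≤ L` for all `t`. -/
def IsLipschitz (L : ℝ) (g : ℤ → ℝ) : Prop :=
  ∀ t : ℤ, |g t - g (t + 1)| ≤ L

/-- `log₂ f` is a (real valued) `L`-Lipschitz map on `ℤ`. That `log₂ f` is real valued means that
`f` is positive everywhere; this has to be said because `Real.logb 2 0 = 0`. -/
def Log2IsLipschitz (L : ℝ) (f : ℤ → ℝ) : Prop :=
  (∀ t, 0 < f t) ∧ IsLipschitz L (fun t => Real.logb 2 (f t))

/-- The average `t ↦ 𝔼_b f (t + b₁ x₁ + ⋯ + bₙ xₙ)` over independent Bernoulli(`p`) variables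
`b₁, …, bₙ`, written as the sum over all values `v ∈ {0, 1}ⁿ` of `(b₁, …, bₙ)`.
(The exponent `n - ∑ j, v j` is a natural number: no truncation occurs.) -/
noncomputable def bernoulliAverage {n : ℕ} (f : ℤ → ℝ) (p : ℝ) (x : Fin n → ℤ) (t : ℤ) : ℝ :=
  ∑ v : Fin n → Fin 2,
    p ^ (∑ j, (v j : ℕ)) * (1 - p) ^ (n - ∑ j, (v j : ℕ)) * f (t + ∑ j, ((v j : ℕ) : ℤ) * x j)

/-- The sup norm `‖g‖_∞` of a bounded function on `ℤ`. -/
noncomputable def supNorm (g : ℤ → ℝ) : ℝ := ⨆ t : ℤ, |g t|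

/-- Averages of `ℓ₁` functions are bounded, so that their `supNorm` is a genuine supremum. -/
theorem bddAbove_bernoulliAverage {n : ℕ} {f : ℤ → ℝ} (hf : Summable fun t => |f t|) (p : ℝ)
    (x : Fin n → ℤ) : BddAbove (Set.range fun t => |bernoulliAverage f p x t|) := by
  refine ⟨∑ v : Fin n → Fin 2,
    |p ^ (∑ j, (v j : ℕ)) * (1 - p) ^ (n - ∑ j, (v j : ℕ))| * ∑' t, |f t|, ?_⟩
  rintro _ ⟨t, rfl⟩
  refine (Finset.abs_sum_le_sum_abs _ _).trans (Finset.sum_le_sum fun v _ => ?_)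
  rw [abs_mul]
  exact mul_le_mul_of_nonneg_left (hf.le_tsum _ fun _ _ => abs_nonneg _) (abs_nonneg _)

end RandomAveraging

/-!
The random function is obtained from `f` by applying, for each `i`, the averaging operator
`step p X_i : g ↦ (1 - p) g + p g(· + X_i)`. These operators commute, so the increments may be
processed in any order. Their expectations may also be compared one at a time: each set `A_i` may be
replaced by an interval of length between `N` and `2 N` inside it for which the bound is worst
(`IsAdmissible.exists_piece`, `exists_pieces`). This reduces the claim to a statement about lists of
intervals, which are split into three groups (`IsAdmissible.exists_groups`).

* The first `κ δ n` increments have modulus at least `N`. By the Erdős-Littlewood-Offord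
  argument (Sperner's theorem, together with a thinning of fair Bernoulli variables for `p < 1/2`),
  averaging over them gives a density with mass at most `C / √n` in every window of length `N`
  (`sum_range_avg_le`, `spread_avg`). Being nearly constant on the scale `H ≈ 1 / η` is preserved
  by averaging, and for `N ≤ H` the window bound is already the claim.

* Let `Φ(g) = ∑ g(t) ^ (q + 1)` over the `t` with `g(t)` above a threshold. A step with a single
  interval increment multiplies the expectation of `Φ` by at most about
  `2 (1 - p + p r) ^ (q + 1)`: the average of `g(t)` and `g(t + X)` exceeds
  `1 - p + p r` times the larger value only if `X` hits a level set, which the window bound makes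
  unlikely (`mean_powSum_step_le`). Since `1 - p + p r < 1 - p + ε` and `N ≤ (1 - p + ε) ^ (-n)`,
  almost all of the increments, used in this way, bring the sup norm down to `R / (N √n)`. The
  failure probability is at most `exp(-M n)` if `q` is large; the constant `R` depends on `q`, and
  hence on `M`.

* The remaining factor `R / L` is removed by `O(κ n)` increments, grouped by the pigeonhole
  principle into pairs of nearby intervals; this step is what makes `L` independent of `M`. After
  averaging over a block of such pairs, `Φ` decreases by a large factor unless `g` is comparable to
  its local maximum on a whole cube generated by differences of the paired increments
  (`expectAvg_block_le`). The level set in question has density at most `1/4` in windows of length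
  `N`, and, at the scale `H`, small boundary. A random cube lies in such a set `D` with tiny
  probability (`cubeProb_le`): the loss `#{z ∈ D | z + x ∉ D}` is subadditive in `x`, so if the
  shifts of small loss were dense in an interval, the Ruzsa covering lemma would make the loss small
  for all shifts up to `N` (`loss_le_of_dense`), which contradicts sparsity. Hence most generators
  shrink the set of admissible base points by a fixed factor. The probability `τ` of an exceptional
  generator can be made arbitrarily small without changing the level `L / (N √n)`, so that the
  `κ n` steps yield `exp(-M n)`.

Both phases are combined through Markov's inequality for `Φ` (`expectAvg_supIndicator_le`).
-/

namespace RandomAveraging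

/-! ### Averaging steps and expectations over lists -/

/-- The averaging operator `f ↦ (1 - p) f + p f(· + x)` of one Bernoulli(`p`) variable with
increment `x`. -/
noncomputable def step (p : ℝ) (x : ℤ) (f : ℤ → ℝ) (t : ℤ) : ℝ := (1 - p) * f t + p * f (t + x)

/-- The composition of the averaging operators with the increments listed in `xs`. -/
noncomputable def avg (p : ℝ) : List ℤ → (ℤ → ℝ) → ℤ → ℝ
  | [], f => f
  | x :: xs, f => avg p xs (step p x f)

/-- The mean of `F` under the uniform distribution on `A`. -/
noncomputable def mean (A : Finset ℤ) (F : ℤ → ℝ) : ℝ := (∑ x ∈ A, F x) / A.card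

/-- The expectation of `G (x₁, …, xₖ)` for independent `xᵢ` uniform on the `i`-th listed set. -/
noncomputable def expect : List (Finset ℤ) → (List ℤ → ℝ) → ℝ
  | [], G => G []
  | A :: L, G => mean A fun x => expect L fun xs => G (x :: xs)

/-- The expectation of the functional `Φ` of the random average of `f`. -/
noncomputable def expectAvg (p : ℝ) (L : List (Finset ℤ)) (Φ : (ℤ → ℝ) → ℝ) (f : ℤ → ℝ) : ℝ :=
  expect L fun xs => Φ (avg p xs f)

theorem step_comm (p : ℝ) (x y : ℤ) (f : ℤ → ℝ) :
    step p x (step p y f) = step p y (step p x f) := by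
  funext t
  simp only [step, add_right_comm t y x]
  ring

theorem avg_step (p : ℝ) (xs : List ℤ) (x : ℤ) (f : ℤ → ℝ) :
    avg p xs (step p x f) = step p x (avg p xs f) := by
  induction xs generalizing f with
  | nil => rfl
  | cons y xs ih => simp only [avg]; rw [step_comm, ih]

theorem avg_append (p : ℝ) (xs ys : List ℤ) (f : ℤ → ℝ) :
    avg p (xs ++ ys) f = avg p ys (avg p xs f) := by
  induction xs generalizing f with
  | nil => rfl
  | cons y xs ih => simp only [List.cons_append, avg, ih]

theorem mean_mono {A : Finset ℤ} {F G : ℤ → ℝ} (h : ∀ x ∈ A, F x ≤ G x) : mean A F ≤ mean A G :=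
  div_le_div_of_nonneg_right (Finset.sum_le_sum h) (Nat.cast_nonneg _)

theorem mean_const {A : Finset ℤ} (hA : A.Nonempty) (c : ℝ) : mean A (fun _ => c) = c := by
  have : (A.card : ℝ) ≠ 0 := by exact_mod_cast hA.card_pos.ne'
  simp only [mean, Finset.sum_const, nsmul_eq_mul]
  field_simp

theorem mean_const_mul (A : Finset ℤ) (c : ℝ) (F : ℤ → ℝ) :
    mean A (fun x => c * F x) = c * mean A F := by
  simp only [mean, ← Finset.mul_sum, mul_div_assoc]

theorem mean_comm (A B : Finset ℤ) (F : ℤ → ℤ → ℝ) :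
    mean A (fun x => mean B (F x)) = mean B (fun y => mean A fun x => F x y) := by
  simp only [mean, ← Finset.sum_div]
  rw [Finset.sum_comm, div_right_comm]

theorem mean_sum {ι : Type*} (s : Finset ι) (A : Finset ℤ) (F : ι → ℤ → ℝ) :
    mean A (fun x => ∑ i ∈ s, F i x) = ∑ i ∈ s, mean A (F i) := by
  simp only [mean, ← Finset.sum_div]
  rw [Finset.sum_comm]

theorem mean_indicator (A : Finset ℤ) (q : ℤ → Prop) [DecidablePred q] :
    mean A (fun x => if q x then 1 else 0) = ((A.filter q).card : ℝ) / A.card := by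
  simp [mean]

theorem expect_mono {L : List (Finset ℤ)} {F G : List ℤ → ℝ}
    (h : ∀ xs, List.Forall₂ (· ∈ ·) xs L → F xs ≤ G xs) : expect L F ≤ expect L G := by
  induction L generalizing F G with
  | nil => exact h [] .nil
  | cons A L ih => exact mean_mono fun x hx => ih fun xs hxs => h _ (.cons hx hxs)

theorem expect_const {L : List (Finset ℤ)} (hL : ∀ A ∈ L, A.Nonempty) (c : ℝ) :
    expect L (fun _ => c) = c := by
  induction L with
  | nil => rfl
  | cons A L ih =>
    simp only [expect]
    rw [ih fun B hB => hL B (List.mem_cons_of_mem _ hB), mean_const (hL A List.mem_cons_self)]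

theorem expect_const_mul (L : List (Finset ℤ)) (c : ℝ) (F : List ℤ → ℝ) :
    expect L (fun x => c * F x) = c * expect L F := by
  induction L generalizing F with
  | nil => rfl
  | cons A L ih => simp only [expect, ih, mean_const_mul]

theorem expect_add (L : List (Finset ℤ)) (F G : List ℤ → ℝ) :
    expect L (fun x => F x + G x) = expect L F + expect L G := by
  induction L generalizing F G with
  | nil => rfl
  | cons A L ih => simp only [expect, ih, mean, Finset.sum_add_distrib, add_div]

theorem expect_sum {ι : Type*} (s : Finset ι) (L : List (Finset ℤ)) (F : ι → List ℤ → ℝ) :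
    expect L (fun x => ∑ i ∈ s, F i x) = ∑ i ∈ s, expect L (F i) := by
  induction L generalizing F with
  | nil => rfl
  | cons A L ih => simp only [expect, ih, mean_sum]

theorem expect_append (L L' : List (Finset ℤ)) (G : List ℤ → ℝ) :
    expect (L ++ L') G = expect L fun xs => expect L' fun ys => G (xs ++ ys) := by
  induction L generalizing G with
  | nil => rfl
  | cons A L ih => simp only [List.cons_append, expect, ih]

theorem expect_le_of_le {L : List (Finset ℤ)} (hL : ∀ A ∈ L, A.Nonempty) {F : List ℤ → ℝ} {c : ℝ}
    (h : ∀ xs, List.Forall₂ (· ∈ ·) xs L → F xs ≤ c) : expect L F ≤ c :=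
  (expect_mono h).trans_eq (expect_const hL c)

theorem expect_nonneg {L : List (Finset ℤ)} {F : List ℤ → ℝ} (h : ∀ xs, 0 ≤ F xs) :
    0 ≤ expect L F := by
  induction L generalizing F with
  | nil => exact h []
  | cons A L ih =>
    exact div_nonneg (Finset.sum_nonneg fun x _ => ih fun xs => h _) (Nat.cast_nonneg _)

/-- Expectations of weighted sums `∑ w s K(xs, s)` may be computed term by term. -/
theorem hasSum_expect {w : ℤ → ℝ} (hw : Summable w) (hw0 : ∀ s, 0 ≤ w s) {C : ℝ}
    (L : List (Finset ℤ)) {κ : List ℤ → ℤ → ℝ} (h0 : ∀ xs s, 0 ≤ κ xs s)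
    (hC : ∀ xs s, κ xs s ≤ C) :
    HasSum (fun s => w s * expect L fun xs => κ xs s)
      (expect L fun xs => ∑' s, w s * κ xs s) := by
  induction L generalizing κ with
  | nil =>
    refine Summable.hasSum (Summable.of_nonneg_of_le (fun s => mul_nonneg (hw0 s) (h0 _ s))
      (fun s => mul_le_mul_of_nonneg_left (hC _ s) (hw0 s)) (hw.mul_right C))
  | cons A L ih =>
    have := (hasSum_sum (s := A) fun x (_ : x ∈ A) =>
      ih (κ := fun xs => κ (x :: xs)) (fun xs => h0 _) (fun xs => hC _)).div_const (A.card : ℝ)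
    simpa only [expect, mean, ← mul_div_assoc, Finset.mul_sum] using this

theorem expect_tsum_le {w : ℤ → ℝ} (hw : Summable w) (hw0 : ∀ s, 0 ≤ w s) {C : ℝ}
    {L : List (Finset ℤ)} {κ : List ℤ → ℤ → ℝ} (h0 : ∀ xs s, 0 ≤ κ xs s)
    (hC : ∀ xs s, κ xs s ≤ C) {β : ℝ} (hβ : ∀ s, w s ≠ 0 → expect L (fun xs => κ xs s) ≤ β) :
    expect L (fun xs => ∑' s, w s * κ xs s) ≤ β * ∑' s, w s := by
  refine hasSum_le (fun s => ?_) (hasSum_expect hw hw0 L h0 hC) (hw.hasSum.mul_left β)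
  by_cases h : w s = 0
  · simp [h]
  · rw [mul_comm β]
    exact mul_le_mul_of_nonneg_left (hβ s h) (hw0 s)

theorem expectAvg_cons (p : ℝ) (A : Finset ℤ) (L : List (Finset ℤ)) (Φ : (ℤ → ℝ) → ℝ)
    (f : ℤ → ℝ) :
    expectAvg p (A :: L) Φ f = mean A fun x => expectAvg p L Φ (step p x f) := rfl

theorem expectAvg_append (p : ℝ) (L L' : List (Finset ℤ)) (Φ : (ℤ → ℝ) → ℝ) (f : ℤ → ℝ) :
    expectAvg p (L ++ L') Φ f = expect L fun xs => expectAvg p L' Φ (avg p xs f) := by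
  simp only [expectAvg, expect_append, avg_append]

theorem expectAvg_perm (p : ℝ) {L L' : List (Finset ℤ)} (h : L.Perm L') (Φ : (ℤ → ℝ) → ℝ)
    (f : ℤ → ℝ) : expectAvg p L Φ f = expectAvg p L' Φ f := by
  induction h generalizing f with
  | nil => rfl
  | cons A _ ih => simp only [expectAvg_cons, ih]
  | swap A B L =>
    simp only [expectAvg_cons]
    rw [mean_comm]
    simp only [step_comm]
  | trans _ _ ih₁ ih₂ => rw [ih₁, ih₂]

/-- The increment of the first set may be averaged out last. -/
theorem expectAvg_cons' (p : ℝ) (A : Finset ℤ) (L : List (Finset ℤ)) (Φ : (ℤ → ℝ) → ℝ)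
    (f : ℤ → ℝ) :
    expectAvg p (A :: L) Φ f = expectAvg p L (fun g => mean A fun x => Φ (step p x g)) f := by
  rw [expectAvg_perm p (List.perm_append_singleton A L).symm, expectAvg_append]
  rfl

theorem avg_ofFn {n : ℕ} (p : ℝ) (x : Fin n → ℤ) (f : ℤ → ℝ) :
    avg p (List.ofFn x) f = bernoulliAverage f p x := by
  induction n generalizing f with
  | zero => funext t; simp [avg, bernoulliAverage]
  | succ n ih =>
    rw [List.ofFn_succ, avg, avg_step, ih]
    funext t
    simp only [step, bernoulliAverage]
    rw [← (Fin.consEquiv fun _ => Fin 2).sum_comp, Fintype.sum_prod_type, Fin.sum_univ_two,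
      Finset.mul_sum, Finset.mul_sum]
    congr 1 <;> refine Finset.sum_congr rfl fun v _ => ?_
    · have hle : ∑ j, (v j : ℕ) ≤ n := by
        calc ∑ j, (v j : ℕ) ≤ ∑ _j : Fin n, 1 := Finset.sum_le_sum fun j _ => by omega
          _ = n := by simp
      simp only [Fin.consEquiv_apply, Fin.sum_univ_succ, Fin.cons_zero, Fin.cons_succ,
        Fin.val_zero, Nat.cast_zero, zero_mul, zero_add]
      rw [Nat.succ_sub hle, pow_succ]
      ring
    · simp only [Fin.consEquiv_apply, Fin.sum_univ_succ, Fin.cons_zero, Fin.cons_succ,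
        Fin.val_one, Nat.cast_one, one_mul]
      rw [add_comm 1 (∑ j, (v j : ℕ)), Nat.add_sub_add_right, pow_succ, ← add_assoc]
      ring

/-! ### Anti-concentration of Bernoulli sums with large increments -/

theorem avg_cons' (p : ℝ) (x : ℤ) (xs : List ℤ) (f : ℤ → ℝ) :
    avg p (x :: xs) f = step p x (avg p xs f) := by
  rw [avg, avg_step]

theorem le_avg {p : ℝ} (hp : 0 ≤ p) (hp1 : p ≤ 1) {a : ℝ} (xs : List ℤ) {f : ℤ → ℝ}
    (h : ∀ t, a ≤ f t) (t : ℤ) : a ≤ avg p xs f t := by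
  induction xs generalizing t with
  | nil => exact h t
  | cons x xs ih =>
    rw [avg_cons', step]
    nlinarith [ih t, ih (t + x)]

theorem avg_le {p : ℝ} (hp : 0 ≤ p) (hp1 : p ≤ 1) {a : ℝ} (xs : List ℤ) {f : ℤ → ℝ}
    (h : ∀ t, f t ≤ a) (t : ℤ) : avg p xs f t ≤ a := by
  induction xs generalizing t with
  | nil => exact h t
  | cons x xs ih =>
    rw [avg_cons', step]
    nlinarith [ih t, ih (t + x)]

/-- The indicator function of the window `[w, w + N)`. -/
noncomputable def window (N : ℕ) (w t : ℤ) : ℝ := if w ≤ t ∧ t < w + N then 1 else 0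

theorem window_nonneg (N : ℕ) (w t : ℤ) : 0 ≤ window N w t := by
  unfold window; split_ifs <;> norm_num

theorem window_le_one (N : ℕ) (w t : ℤ) : window N w t ≤ 1 := by
  unfold window; split_ifs <;> norm_num

/-- For fair Bernoulli variables, increments may be replaced by their absolute values. -/
theorem exists_avg_half_eq_abs (xs : List ℤ) (F : ℤ → ℝ) :
    ∃ c : ℤ, ∀ s, avg (1 / 2) xs F s = avg (1 / 2) (xs.map abs) F (s + c) := by
  induction xs with
  | nil => exact ⟨0, fun s => by simp [avg]⟩
  | cons x xs ih =>
    obtain ⟨c, hc⟩ := ih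
    rcases le_total 0 x with hx | hx
    · refine ⟨c, fun s => ?_⟩
      rw [List.map_cons, avg_cons', avg_cons', step, step, hc, hc, abs_of_nonneg hx,
        add_right_comm]
    · refine ⟨c + x, fun s => ?_⟩
      rw [List.map_cons, avg_cons', avg_cons', step, step, hc, hc, abs_of_nonpos hx,
        show s + (c + x) + -x = s + c by ring, show s + x + c = s + (c + x) by ring]
      ring

/-- The Erdős-Littlewood-Offord bound: sums of increments `≥ N` which fall into a window of length
`N` come from an antichain of index sets. -/
theorem avg_half_window_le_choose {N : ℕ} {k : ℕ} (y : Fin k → ℤ)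
    (hy : ∀ i, (N : ℤ) ≤ y i) (w s : ℤ) :
    avg (1 / 2) (List.ofFn y) (window N w) s ≤ (k.choose (k / 2) : ℝ) / 2 ^ k := by
  classical
  rw [avg_ofFn]
  let S : (Fin k → Fin 2) → Finset (Fin k) := fun v => Finset.univ.filter fun j => v j = 1
  have hS : Function.Injective S := by
    intro v v' h
    funext j
    have : v j = 1 ↔ v' j = 1 := by
      have := congrArg (j ∈ ·) h
      simpa [S] using this
    have h1 := (v j).isLt
    have h2 := (v' j).isLt
    simp only [Fin.ext_iff, Fin.val_one] at this ⊢
    omega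
  have hsum : ∀ v : Fin k → Fin 2, ∑ j, ((v j : ℕ) : ℤ) * y j = ∑ j ∈ S v, y j := by
    intro v
    rw [Finset.sum_filter]
    refine Finset.sum_congr rfl fun j _ => ?_
    generalize v j = b
    fin_cases b <;> simp
  let V : Finset (Fin k → Fin 2) :=
    Finset.univ.filter fun v => w ≤ s + ∑ j ∈ S v, y j ∧ s + ∑ j ∈ S v, y j < w + N
  have hV : bernoulliAverage (window N w) (1 / 2) y s = (V.card : ℝ) / 2 ^ k := by
    have : ∀ v : Fin k → Fin 2, (1 / 2 : ℝ) ^ (∑ j, (v j : ℕ)) *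
        (1 - 1 / 2) ^ (k - ∑ j, (v j : ℕ)) * window N w (s + ∑ j, ((v j : ℕ) : ℤ) * y j) =
        (if v ∈ V then 1 else 0) / 2 ^ k := by
      intro v
      have hle : ∑ j, (v j : ℕ) ≤ k := by
        calc ∑ j, (v j : ℕ) ≤ ∑ _j : Fin k, 1 := Finset.sum_le_sum fun j _ => by omega
          _ = k := by simp
      rw [hsum, show (1 - 1 / 2 : ℝ) = 1 / 2 by norm_num, ← pow_add, Nat.add_sub_cancel' hle,
        one_div, inv_pow]
      simp only [window, V, Finset.mem_filter, Finset.mem_univ, true_and]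
      ring
    rw [bernoulliAverage, Finset.sum_congr rfl fun v _ => this v, ← Finset.sum_div]
    simp
  rw [hV]
  refine div_le_div_of_nonneg_right ?_ (by positivity)
  have hanti : IsAntichain (fun a b : Finset (Fin k) => a ⊆ b)
      ((V.image S : Finset (Finset (Fin k))) : Set (Finset (Fin k))) := by
    intro a ha b hb hab hsub
    simp only [Finset.coe_image, Set.mem_image, Finset.mem_coe, V, Finset.mem_filter,
      Finset.mem_univ, true_and] at ha hb
    obtain ⟨v, hv, rfl⟩ := ha
    obtain ⟨v', hv', rfl⟩ := hb
    obtain ⟨j, hj⟩ := Finset.exists_of_ssubset (hsub.ssubset_of_ne hab)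
    have h1 : ∑ i ∈ S v' \ S v, y i + ∑ i ∈ S v, y i = ∑ i ∈ S v', y i :=
      Finset.sum_sdiff hsub
    have h2 : y j ≤ ∑ i ∈ S v' \ S v, y i :=
      Finset.single_le_sum (fun i _ => (Int.natCast_nonneg N).trans (hy i))
        (Finset.mem_sdiff.2 hj)
    have := hy j
    omega
  have := hanti.sperner
  rw [Finset.card_image_of_injective _ hS, Fintype.card_fin] at this
  exact_mod_cast this

theorem centralBinom_sq_le (j : ℕ) : j.centralBinom ^ 2 * (2 * j + 1) ≤ 16 ^ j := by
  induction j with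
  | zero => simp
  | succ j ih =>
    have h := Nat.succ_mul_centralBinom_succ j
    have h2 : (j + 1) ^ 2 * ((j + 1).centralBinom ^ 2 * (2 * (j + 1) + 1)) ≤
        (j + 1) ^ 2 * 16 ^ (j + 1) := by
      calc (j + 1) ^ 2 * ((j + 1).centralBinom ^ 2 * (2 * (j + 1) + 1))
          = ((j + 1) * (j + 1).centralBinom) ^ 2 * (2 * j + 3) := by ring
        _ = 4 * ((2 * j + 1) * (2 * j + 3)) * (j.centralBinom ^ 2 * (2 * j + 1)) := by
            rw [h]; ring
        _ ≤ 4 * (4 * (j + 1) ^ 2) * 16 ^ j := by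
            refine Nat.mul_le_mul (Nat.mul_le_mul_left 4 ?_) ih
            nlinarith
        _ = (j + 1) ^ 2 * 16 ^ (j + 1) := by ring
    exact Nat.le_of_mul_le_mul_left h2 (by positivity)

theorem choose_half_sq_le (k : ℕ) : ((k.choose (k / 2) : ℝ) / 2 ^ k) ^ 2 ≤ 1 / (k + 1) := by
  have key : k.choose (k / 2) ^ 2 * (k + 1) ≤ 4 ^ k := by
    rcases Nat.even_or_odd' k with ⟨j, rfl | rfl⟩
    · have := centralBinom_sq_le j
      rw [Nat.centralBinom] at this
      rw [Nat.mul_div_cancel_left _ two_pos, pow_mul]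
      exact this
    · have h := centralBinom_sq_le (j + 1)
      have h2 : (j + 1).centralBinom = 2 * (2 * j + 1).choose j := by
        rw [Nat.centralBinom, show 2 * (j + 1) = 2 * j + 1 + 1 by ring, Nat.choose_succ_succ,
          Nat.choose_symm_half]
        ring
      rw [show (2 * j + 1) / 2 = j by omega]
      rw [h2] at h
      have h3 : (4 : ℕ) ^ (2 * j + 1) = 4 * 16 ^ j := by rw [pow_succ, pow_mul]; ring
      rw [h3]
      have h4 : (16 : ℕ) ^ (j + 1) = 16 * 16 ^ j := by ring
      rw [h4] at h
      nlinarith [sq_nonneg ((2 * j + 1).choose j)]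
  have key' : ((k.choose (k / 2) : ℝ)) ^ 2 * (k + 1) ≤ (2 ^ k) ^ 2 := by
    rw [← pow_mul, mul_comm k 2, pow_mul]
    norm_num
    exact_mod_cast key
  rw [div_pow, div_le_div_iff₀ (by positivity) (by positivity)]
  linarith

theorem avg_half_window_sq_le {N : ℕ} {ys : List ℤ} (hy : ∀ y ∈ ys, (N : ℤ) ≤ |y|)
    (w s : ℤ) : avg (1 / 2) ys (window N w) s ^ 2 ≤ 1 / (ys.length + 1) := by
  obtain ⟨c, hc⟩ := exists_avg_half_eq_abs ys (window N w)
  rw [hc]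
  have h1 := avg_half_window_le_choose (ys.map abs).get
    (fun i => by
      obtain ⟨y, hy', h⟩ := List.mem_map.1 (List.get_mem (ys.map abs) i)
      rw [← h]
      exact hy y hy') w (s + c)
  rw [List.ofFn_get] at h1
  have h2 := choose_half_sq_le (ys.map abs).length
  have h0 := le_avg (by norm_num : (0 : ℝ) ≤ 1 / 2) (by norm_num) (ys.map abs)
    (window_nonneg N w) (s + c)
  refine (pow_le_pow_left₀ h0 h1 2).trans (h2.trans_eq ?_)
  rw [List.length_map]

theorem avg_add_mul (p a b : ℝ) (xs : List ℤ) (f g : ℤ → ℝ) :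
    avg p xs (fun t => a * f t + b * g t) = fun t => a * avg p xs f t + b * avg p xs g t := by
  induction xs with
  | nil => rfl
  | cons x xs ih =>
    rw [avg_cons', avg_cons', avg_cons', ih]
    funext t
    simp only [step]
    ring

/-- A Bernoulli(`p`) variable is the product of a Bernoulli(`2p`) variable and a fair one, so the
bound for fair variables extends to all `p ≤ 1/2`.  The function `1 / (k + 1 + p m)` is chosen to
be superharmonic for the random walk that moves `(m + 1, k)` to `(m, k)` or, with probability `2p`,
to `(m, k + 1)`. -/
theorem avg_avg_half_window_sq_le {p : ℝ} (hp : 0 ≤ p) (hp2 : p ≤ 1 / 2) {N : ℕ}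
    {xs : List ℤ} (hx : ∀ x ∈ xs, (N : ℤ) ≤ |x|) {ys : List ℤ} (hy : ∀ y ∈ ys, (N : ℤ) ≤ |y|)
    (w s : ℤ) :
    avg p xs (avg (1 / 2) ys (window N w)) s ^ 2 ≤ 1 / (ys.length + 1 + p * xs.length) := by
  induction xs generalizing ys with
  | nil => simpa [avg] using avg_half_window_sq_le hy w s
  | cons x xs ih =>
    have hstep : step p x (avg (1 / 2) ys (window N w)) = fun t =>
        (1 - 2 * p) * avg (1 / 2) ys (window N w) t +
          (2 * p) * avg (1 / 2) (x :: ys) (window N w) t := by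
      funext t
      rw [avg_cons']
      simp only [step]
      ring
    rw [avg, hstep, avg_add_mul]
    have h1 := ih (fun z hz => hx z (List.mem_cons_of_mem _ hz)) hy
    have h2 := ih (fun z hz => hx z (List.mem_cons_of_mem _ hz)) (ys := x :: ys)
      (fun z hz => by
        rcases List.mem_cons.1 hz with rfl | hz
        exacts [hx _ List.mem_cons_self, hy z hz])
    simp only [List.length_cons, Nat.cast_add, Nat.cast_one] at h2 ⊢
    set A := avg p xs (avg (1 / 2) ys (window N w)) s
    set B := avg p xs (avg (1 / 2) (x :: ys) (window N w)) s
    set Z : ℝ := ys.length + 1 + p * xs.length with hZ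
    have hZ1 : 1 ≤ Z := by
      rw [hZ]
      nlinarith [ys.length.cast_nonneg (α := ℝ),
        mul_nonneg hp (xs.length.cast_nonneg (α := ℝ))]
    have e2 : (ys.length : ℝ) + 1 + 1 + p * xs.length = Z + 1 := by rw [hZ]; ring
    have e3 : (ys.length : ℝ) + 1 + p * (xs.length + 1) = Z + p := by rw [hZ]; ring
    rw [e2] at h2
    rw [e3]
    calc ((1 - 2 * p) * A + 2 * p * B) ^ 2 ≤ (1 - 2 * p) * A ^ 2 + 2 * p * B ^ 2 := by
          nlinarith [mul_nonneg (mul_nonneg hp (by linarith : 0 ≤ 1 - 2 * p)) (sq_nonneg (A - B))]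
      _ ≤ (1 - 2 * p) * (1 / Z) + 2 * p * (1 / (Z + 1)) := by
          have := mul_le_mul_of_nonneg_left h1 (by linarith : 0 ≤ 1 - 2 * p)
          have := mul_le_mul_of_nonneg_left h2 (by linarith : 0 ≤ 2 * p)
          linarith
      _ ≤ 1 / (Z + p) := by
          have hZ0 : 0 < Z := by linarith
          have hZ2 : 0 < Z + p := by linarith
          rw [mul_one_div, mul_one_div, div_add_div _ _ hZ0.ne' (by linarith),
            div_le_div_iff₀ (by positivity) hZ2]
          nlinarith [mul_nonneg hp (sub_nonneg.2 hZ1)]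

theorem avg_window_le {p : ℝ} (hp : 0 ≤ p) (hp2 : p ≤ 1 / 2) {N : ℕ}
    {xs : List ℤ} (hx : ∀ x ∈ xs, (N : ℤ) ≤ |x|) (w s : ℤ) :
    avg p xs (window N w) s ≤ 1 / √(1 + p * xs.length) := by
  have h := avg_avg_half_window_sq_le hp hp2 hx (ys := []) (by simp) w s
  simp only [avg, List.length_nil, Nat.cast_zero, zero_add] at h
  rw [← Real.sqrt_one, ← Real.sqrt_div' _ (by positivity), Real.sqrt_one]
  exact Real.le_sqrt_of_sq_le h

theorem summable_step {p : ℝ} {x : ℤ} {f : ℤ → ℝ} (hf : Summable f) : Summable (step p x f) :=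
  (hf.mul_left _).add (((Equiv.addRight x).summable_iff.2 hf).mul_left _)

theorem summable_mul_of_bounded {f F : ℤ → ℝ} (hf : Summable f) (hf0 : ∀ t, 0 ≤ f t)
    (hF0 : ∀ t, 0 ≤ F t) (hF1 : ∀ t, F t ≤ 1) : Summable fun t => f t * F t :=
  Summable.of_nonneg_of_le (fun t => mul_nonneg (hf0 t) (hF0 t))
    (fun t => mul_le_of_le_one_right (hf0 t) (hF1 t)) hf

/-- The adjoint of averaging with increments `xs` is averaging with increments `-xs`. -/
theorem tsum_avg_mul {p : ℝ} (hp : 0 ≤ p) (hp1 : p ≤ 1) (xs : List ℤ) {f F : ℤ → ℝ}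
    (hf : Summable f) (hf0 : ∀ t, 0 ≤ f t) (hF0 : ∀ t, 0 ≤ F t) (hF1 : ∀ t, F t ≤ 1) :
    ∑' t, avg p xs f t * F t = ∑' t, f t * avg p (xs.map (-·)) F t := by
  induction xs generalizing f with
  | nil => rfl
  | cons x xs ih =>
    rw [avg, ih (summable_step hf) (le_avg hp hp1 [x] hf0), List.map_cons, avg_cons']
    set G := avg p (xs.map (-·)) F
    have hG0 : ∀ t, 0 ≤ G t := le_avg hp hp1 _ hF0
    have hG1 : ∀ t, G t ≤ 1 := avg_le hp hp1 _ hF1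
    have hs := summable_mul_of_bounded hf hf0 hG0 hG1
    have hs1 : Summable fun t => f (t + x) * G t :=
      summable_mul_of_bounded ((Equiv.addRight x).summable_iff.2 hf) (fun t => hf0 _) hG0 hG1
    have hs2 := summable_mul_of_bounded hf hf0 (fun t => hG0 (t + -x)) (fun t => hG1 (t + -x))
    have e : ∑' t, f (t + x) * G t = ∑' t, f t * G (t + -x) := by
      rw [← (Equiv.addRight x).tsum_eq fun t => f t * G (t + -x)]
      simp
    calc ∑' t, step p x f t * G t
        = ∑' t, ((1 - p) * (f t * G t) + p * (f (t + x) * G t)) := by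
          congr 1; funext t; simp only [step]; ring
      _ = (1 - p) * ∑' t, f t * G t + p * ∑' t, f (t + x) * G t := by
          rw [Summable.tsum_add (hs.mul_left _) (hs1.mul_left _), tsum_mul_left, tsum_mul_left]
      _ = ∑' t, ((1 - p) * (f t * G t) + p * (f t * G (t + -x))) := by
          rw [e, Summable.tsum_add (hs.mul_left _) (hs2.mul_left _), tsum_mul_left, tsum_mul_left]
      _ = _ := by
          congr 1; funext t; simp only [step]; ring

/-- After averaging with increments of modulus at least `N`, windows of length `N` have small
mass. -/
theorem sum_range_avg_le {p : ℝ} (hp : 0 ≤ p) (hp2 : p ≤ 1 / 2) {N : ℕ}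
    {xs : List ℤ} (hx : ∀ x ∈ xs, (N : ℤ) ≤ |x|) {f : ℤ → ℝ} (hf0 : ∀ t, 0 ≤ f t)
    (hf : HasSum f 1) (t : ℤ) :
    ∑ j ∈ Finset.range N, avg p xs f (t + j) ≤ 1 / √(1 + p * xs.length) := by
  have hp1 : p ≤ 1 := by linarith
  have h1 : ∑ j ∈ Finset.range N, avg p xs f (t + j) = ∑' s, avg p xs f s * window N t s := by
    have hinj : Function.Injective fun j : ℕ => t + (j : ℤ) := fun a b h => by simpa using h
    rw [tsum_eq_sum (s := (Finset.range N).image fun j : ℕ => t + (j : ℤ)),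
      Finset.sum_image hinj.injOn]
    · refine Finset.sum_congr rfl fun j hj => ?_
      rw [Finset.mem_range] at hj
      rw [window, if_pos (by omega), mul_one]
    · intro s hs
      rw [window, if_neg, mul_zero]
      rintro ⟨h1, h2⟩
      exact hs (Finset.mem_image.2 ⟨(s - t).toNat, by rw [Finset.mem_range]; omega, by omega⟩)
  rw [h1, tsum_avg_mul hp hp1 xs hf.summable hf0 (window_nonneg N t) (window_le_one N t)]
  have hb : ∀ s, avg p (xs.map (-·)) (window N t) s ≤ 1 / √(1 + p * xs.length) := by
    intro s
    have := avg_window_le hp hp2 (xs := xs.map (-·)) (fun x hx' => by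
      obtain ⟨y, hy, rfl⟩ := List.mem_map.1 hx'
      rw [abs_neg]; exact hx y hy) t s
    rwa [List.length_map] at this
  have hs := summable_mul_of_bounded hf.summable hf0
    (le_avg hp hp1 (xs.map (-·)) (window_nonneg N t))
    (avg_le hp hp1 (xs.map (-·)) (window_le_one N t))
  have := hasSum_le (fun s => mul_le_mul_of_nonneg_left (hb s) (hf0 s)) hs.hasSum
    (hf.mul_right (1 / √(1 + p * xs.length)))
  rwa [one_mul] at this

/-! ### Random cubes in sparse sets of integers -/

/-- The number of points of `D` which the shift by `x` moves out of `D`. -/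
def loss (D : Finset ℤ) (x : ℤ) : ℕ := (D.filter fun z => z + x ∉ D).card

theorem card_filter_add_mem_add_loss (D : Finset ℤ) (x : ℤ) :
    (D.filter fun z => z + x ∈ D).card + loss D x = D.card :=
  Finset.card_filter_add_card_filter_not _

/-- The loss is subadditive: it is half the `ℓ₁` distance between the indicator functions of `D` and
of its translate. -/
theorem loss_add_le (D : Finset ℤ) (x y : ℤ) : loss D (x + y) ≤ loss D x + loss D y := by
  unfold loss
  have h : (D.filter fun z => z + (x + y) ∉ D) ⊆
      (D.filter fun z => z + x ∉ D) ∪ (D.filter fun z => z + y ∉ D).image (· - x) := by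
    intro z hz
    rw [Finset.mem_filter] at hz
    by_cases hx : z + x ∈ D
    · refine Finset.mem_union_right _ (Finset.mem_image.2 ⟨z + x, ?_, by ring⟩)
      rw [Finset.mem_filter, add_assoc]
      exact ⟨hx, hz.2⟩
    · exact Finset.mem_union_left _ (Finset.mem_filter.2 ⟨hz.1, hx⟩)
  exact (Finset.card_le_card h).trans ((Finset.card_union_le _ _).trans
    (Nat.add_le_add_left Finset.card_image_le _))

theorem loss_neg (D : Finset ℤ) (x : ℤ) : loss D (-x) = loss D x := by
  have h : (D.filter fun z => z + -x ∈ D).card = (D.filter fun z => z + x ∈ D).card := by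
    refine Finset.card_bij' (fun z _ => z + -x) (fun z _ => z + x) ?_ ?_ ?_ ?_ <;>
      simp +contextual [Finset.mem_filter]
  have h1 := card_filter_add_mem_add_loss D x
  have h2 := card_filter_add_mem_add_loss D (-x)
  omega

theorem loss_sub_le (D : Finset ℤ) (x y : ℤ) : loss D (x - y) ≤ loss D x + loss D y := by
  rw [sub_eq_add_neg, ← loss_neg D y]
  exact loss_add_le _ _ _

/-- Passing to the points that survive a shift at most doubles the boundary. -/
theorem loss_filter_le (D : Finset ℤ) (d x : ℤ) :
    loss (D.filter fun z => z + d ∈ D) x ≤ 2 * loss D x := by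
  unfold loss
  have h : ((D.filter fun z => z + d ∈ D).filter fun z => z + x ∉ D.filter fun z => z + d ∈ D) ⊆
      (D.filter fun z => z + x ∉ D) ∪ (D.filter fun z => z + x ∉ D).image (· - d) := by
    intro z hz
    simp only [Finset.mem_filter] at hz
    by_cases hx : z + x ∈ D
    · refine Finset.mem_union_right _ (Finset.mem_image.2 ⟨z + d, ?_, by ring⟩)
      rw [Finset.mem_filter]
      refine ⟨hz.1.2, fun h => hz.2 ⟨hx, ?_⟩⟩
      rwa [add_right_comm]
    · exact Finset.mem_union_left _ (Finset.mem_filter.2 ⟨hz.1.1, hx⟩)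
  refine (Finset.card_le_card h).trans ((Finset.card_union_le _ _).trans ?_)
  rw [two_mul]
  exact Nat.add_le_add_left Finset.card_image_le _

open scoped Pointwise in
/-- If the shifts with small loss contain `1` and a dense part `T` of an interval, then all shifts
up to `N` have small loss.  By the Ruzsa covering lemma, `[0, N)` is covered by few translates of
`T - T`; walking from `0` in unit steps, each of these translates has to be crossed only once. -/
theorem loss_le_of_dense {D T : Finset ℤ} {N : ℕ} {ℓ τ : ℝ} (hτ : 0 < τ) (hN : 1 ≤ N)
    (h1 : (loss D 1 : ℝ) ≤ ℓ) (hT : ∀ x ∈ T, (loss D x : ℝ) ≤ ℓ) {c : ℤ}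
    (hTc : T ⊆ Finset.Ico c (c + 2 * N)) (hcard : τ * N ≤ T.card) {x : ℕ} (hx : x < N) :
    (loss D x : ℝ) ≤ 15 / τ * ℓ := by
  classical
  have hℓ : 0 ≤ ℓ := (Nat.cast_nonneg _).trans h1
  have hN0 : (0 : ℝ) < N := by exact_mod_cast hN
  have hTpos : (0 : ℝ) < T.card := (mul_pos hτ hN0).trans_le hcard
  have hTne : T.Nonempty := Finset.card_pos.1 (by exact_mod_cast hTpos)
  have hsum : ((Finset.Ico (0 : ℤ) N + T).card : ℝ) ≤ 3 / τ * T.card := by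
    have hsub : Finset.Ico (0 : ℤ) N + T ⊆ Finset.Ico c (c + 3 * N) := by
      intro z hz
      obtain ⟨a, ha, b, hb, rfl⟩ := Finset.mem_add.1 hz
      have := Finset.mem_Ico.1 ha
      have := Finset.mem_Ico.1 (hTc hb)
      rw [Finset.mem_Ico]
      omega
    have h3 : ((Finset.Ico (0 : ℤ) N + T).card : ℝ) ≤ 3 * N := by
      have := Finset.card_le_card hsub
      rw [Int.card_Ico, show (c + 3 * (N : ℤ) - c).toNat = 3 * N by omega] at this
      exact_mod_cast this
    calc _ ≤ 3 * (N : ℝ) := h3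
      _ = 3 / τ * (τ * N) := by field_simp
      _ ≤ _ := by gcongr
  obtain ⟨F, -, hF, hcov⟩ := Finset.ruzsa_covering_add hTne hsum
  have hc : ∀ y : ℕ, ∃ f : ℤ, y < N → f ∈ F ∧ (loss D (y - f) : ℝ) ≤ 2 * ℓ := by
    intro y
    by_cases hy : y < N
    · have : (y : ℤ) ∈ Finset.Ico (0 : ℤ) N := by rw [Finset.mem_Ico]; omega
      obtain ⟨f, hf, g, hg, hfg⟩ := Finset.mem_add.1 (hcov this)
      obtain ⟨b, hb, b', hb', rfl⟩ := Finset.mem_sub.1 hg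
      refine ⟨f, fun _ => ⟨hf, ?_⟩⟩
      rw [← hfg, add_sub_cancel_left]
      have : (loss D (b - b') : ℝ) ≤ loss D b + loss D b' := by exact_mod_cast loss_sub_le D b b'
      linarith [hT b hb, hT b' hb']
    · exact ⟨0, fun h => absurd h hy⟩
  choose g hg using hc
  have key : ∀ y : ℕ, y < N →
      (loss D y : ℝ) ≤ 5 * ℓ * ((Finset.range (y + 1)).image g).card := by
    intro y
    induction y using Nat.strong_induction_on with
    | _ y ih =>
      intro hy
      have hex : ∃ u, g u = g y := ⟨y, rfl⟩
      -- `u` is the first point in the translate that contains `y`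
      let u := Nat.find hex
      have hu : g u = g y := Nat.find_spec hex
      have huy : u ≤ y := Nat.find_min' hex rfl
      have hmove : (loss D ((y : ℤ) - u) : ℝ) ≤ 4 * ℓ := by
        have h2 := (hg y hy).2
        have h3 := (hg u (by omega)).2
        rw [hu] at h3
        have h4 : (loss D ((y - g y) - (u - g y)) : ℝ) ≤ loss D (y - g y) + loss D (u - g y) := by
          exact_mod_cast loss_sub_le D _ _
        rw [sub_sub_sub_cancel_right] at h4
        linarith
      rcases Nat.eq_zero_or_pos u with h0 | hpos
      · have hone : (1 : ℝ) ≤ ((Finset.range (y + 1)).image g).card := by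
          have : ((Finset.range (y + 1)).image g).Nonempty :=
            ⟨g y, Finset.mem_image_of_mem g (Finset.self_mem_range_succ y)⟩
          exact_mod_cast this.card_pos
        rw [h0] at hmove
        simp only [Nat.cast_zero, sub_zero] at hmove
        nlinarith
      · have h2 := ih (u - 1) (by omega) (by omega)
        rw [Nat.sub_add_cancel hpos] at h2
        have hnot : g y ∉ (Finset.range u).image g := by
          intro h
          obtain ⟨v, hv, hvy⟩ := Finset.mem_image.1 h
          exact Nat.find_min hex (Finset.mem_range.1 hv) hvy
        have hcard : (((Finset.range u).image g).card : ℝ) + 1 ≤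
            ((Finset.range (y + 1)).image g).card := by
          have : insert (g y) ((Finset.range u).image g) ⊆ (Finset.range (y + 1)).image g := by
            refine Finset.insert_subset
              (Finset.mem_image_of_mem g (Finset.self_mem_range_succ y)) ?_
            exact Finset.image_subset_image (Finset.range_subset_range.2 (by omega))
          have := Finset.card_le_card this
          rw [Finset.card_insert_of_notMem hnot] at this
          exact_mod_cast this
        have h5 : (loss D y : ℝ) ≤ loss D ((y : ℤ) - u) + loss D (u : ℤ) := by
          have := loss_add_le D ((y : ℤ) - u) u
          rw [sub_add_cancel] at this
          exact_mod_cast this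
        have h6 : (loss D (u : ℤ) : ℝ) ≤ loss D ((u - 1 : ℕ) : ℤ) + loss D 1 := by
          have := loss_add_le D ((u - 1 : ℕ) : ℤ) 1
          rw [show ((u - 1 : ℕ) : ℤ) + 1 = u by omega] at this
          exact_mod_cast this
        nlinarith
  have hle : (((Finset.range (x + 1)).image g).card : ℝ) ≤ 3 / τ := by
    refine le_trans ?_ hF
    have : (Finset.range (x + 1)).image g ⊆ F := by
      intro f hf
      obtain ⟨v, hv, rfl⟩ := Finset.mem_image.1 hf
      exact (hg v (by have := Finset.mem_range.1 hv; omega)).1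
    exact_mod_cast Finset.card_le_card this
  calc (loss D x : ℝ) ≤ _ := key x hx
    _ ≤ 5 * ℓ * (3 / τ) := by gcongr
    _ = 15 / τ * ℓ := by ring

/-- A nonempty set of density at most `1/4` in all windows of length `N` cannot be almost invariant
under all shifts up to `N`. -/
theorem exists_lt_loss {D : Finset ℤ} {N : ℕ} (hN : 1 ≤ N) (hD : D.Nonempty)
    (hsparse : ∀ z : ℤ, (((Finset.range N).filter fun j : ℕ => z + j ∈ D).card : ℝ) ≤ N / 4) :
    ∃ x < N, (D.card : ℝ) / 2 < loss D x := by
  by_contra! h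
  have hN0 : (0 : ℝ) < N := by exact_mod_cast hN
  have hD0 : (0 : ℝ) < D.card := by exact_mod_cast hD.card_pos
  have hlow : (N : ℝ) * (D.card / 2) ≤
      ∑ x ∈ Finset.range N, ((D.filter fun z => z + (x : ℤ) ∈ D).card : ℝ) := by
    rw [← nsmul_eq_mul, ← Finset.card_range N, ← Finset.sum_const, Finset.card_range]
    refine Finset.sum_le_sum fun x hx => ?_
    have h1 := h x (Finset.mem_range.1 hx)
    have h2 : ((D.filter fun z => z + (x : ℤ) ∈ D).card : ℝ) + loss D x = D.card := by
      exact_mod_cast card_filter_add_mem_add_loss D x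
    linarith
  have hswap : ∑ x ∈ Finset.range N, ((D.filter fun z => z + (x : ℤ) ∈ D).card : ℝ) =
      ∑ z ∈ D, (((Finset.range N).filter fun j : ℕ => z + j ∈ D).card : ℝ) := by
    simp only [Finset.card_filter, Nat.cast_sum]
    rw [Finset.sum_comm]
  have hup : ∑ z ∈ D, (((Finset.range N).filter fun j : ℕ => z + j ∈ D).card : ℝ) ≤
      D.card * (N / 4) := by
    rw [← nsmul_eq_mul, ← Finset.sum_const]
    exact Finset.sum_le_sum fun z _ => hsparse z
  have := mul_pos hN0 hD0
  linarith

/-- For a sparse set `D` with small boundary, few shifts in an interval have small loss. -/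
theorem card_small_loss_le {D I : Finset ℤ} {N : ℕ} {τ : ℝ} (hτ : 0 < τ) (hN : 1 ≤ N)
    (hsparse : ∀ z : ℤ, (((Finset.range N).filter fun j : ℕ => z + j ∈ D).card : ℝ) ≤ N / 4)
    (hD : D.Nonempty) (h1 : (loss D 1 : ℝ) ≤ τ / 30 * D.card) {c : ℤ}
    (hIc : I ⊆ Finset.Ico c (c + 2 * N)) (hI : N ≤ I.card) :
    ((I.filter fun x => (loss D x : ℝ) ≤ τ / 30 * D.card).card : ℝ) ≤ τ * I.card := by
  by_contra! h
  obtain ⟨x, hx, hlt⟩ := exists_lt_loss hN hD hsparse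
  have hNI : (N : ℝ) ≤ I.card := by exact_mod_cast hI
  have := loss_le_of_dense hτ hN h1 (fun y hy => (Finset.mem_filter.1 hy).2)
    ((Finset.filter_subset _ _).trans hIc)
    ((mul_le_mul_of_nonneg_left hNI hτ.le).trans h.le) hx
  rw [show 15 / τ * (τ / 30 * (D.card : ℝ)) = D.card / 2 by field_simp; norm_num] at this
  linarith

/-- The cube `{∑ k, v k * d k | v ∈ {0, 1}ᵏ}` generated by the listed integers lies in `E`. -/
def HasCube : (ℤ → Prop) → List ℤ → Prop
  | E, [] => E 0
  | E, d :: ds => HasCube (fun z => E z ∧ E (z + d)) ds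

theorem HasCube.mono {E E' : ℤ → Prop} (h : ∀ z, E z → E' z) {ds : List ℤ} (hE : HasCube E ds) :
    HasCube E' ds := by
  induction ds generalizing E E' with
  | nil => exact h 0 hE
  | cons d ds ih => exact ih (fun z hz => ⟨h _ hz.1, h _ hz.2⟩) hE

theorem HasCube.zero {E : ℤ → Prop} {ds : List ℤ} (hE : HasCube E ds) : E 0 := by
  induction ds generalizing E with
  | nil => exact hE
  | cons d ds ih => exact (ih hE).1

theorem hasCube_cons_mem (D : Finset ℤ) (d : ℤ) (ds : List ℤ) :
    HasCube (· ∈ D) (d :: ds) ↔ HasCube (· ∈ D.filter fun z => z + d ∈ D) ds := by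
  simp only [HasCube, Finset.mem_filter]

/-- A random increment: `g y` for `y` uniform on `I`, where `g` maps `I` injectively into an
interval of length `2 N`. -/
structure IsIncrement (N : ℕ) (I : Finset ℤ) (g : ℤ → ℤ) : Prop where
  card_le : N ≤ I.card
  inj : Function.Injective g
  range : ∃ c : ℤ, ∀ y ∈ I, g y ∈ Finset.Ico c (c + 2 * N)

/-- The increments produced from the values `ys` by the maps listed in `M`. -/
def increments (M : List (Finset ℤ × (ℤ → ℤ))) (ys : List ℤ) : List ℤ :=
  List.zipWith (fun m y => m.2 y) M ys

open Classical in
/-- The probability that a cube with random generators lies in `D`. -/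
noncomputable def cubeProb (D : Finset ℤ) (M : List (Finset ℤ × (ℤ → ℤ))) : ℝ :=
  expect (M.map Prod.fst) fun ys => if HasCube (· ∈ D) (increments M ys) then 1 else 0

theorem cubeProb_cons (D : Finset ℤ) (m : Finset ℤ × (ℤ → ℤ)) (M : List (Finset ℤ × (ℤ → ℤ))) :
    cubeProb D (m :: M) =
      mean m.1 fun y => cubeProb (D.filter fun z => z + m.2 y ∈ D) M := by
  classical
  refine congrArg (mean m.1) (funext fun y => congrArg (expect _) (funext fun ys => ?_))
  exact if_congr (hasCube_cons_mem D (m.2 y) (increments M ys)) rfl rfl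

theorem cubeProb_nonneg (D : Finset ℤ) (M : List (Finset ℤ × (ℤ → ℤ))) : 0 ≤ cubeProb D M :=
  expect_nonneg fun xs => by split_ifs <;> norm_num

theorem cubeProb_cons_eq_zero {D : Finset ℤ} {d : ℤ} (hd : d ∉ D)
    (M : List (Finset ℤ × (ℤ → ℤ))) : cubeProb (D.filter fun z => z + d ∈ D) M = 0 := by
  refine le_antisymm ?_ (cubeProb_nonneg _ _)
  have : ∀ ys, ¬ HasCube (· ∈ D.filter fun z => z + d ∈ D) (increments M ys) := fun ys h =>
    hd (by simpa using (Finset.mem_filter.1 h.zero).2)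
  simp only [cubeProb, this, if_false]
  have := expect_const_mul (M.map Prod.fst) 0 fun _ => 0
  simpa using this.le

theorem mean_indicator_mem_le {N : ℕ} {τ : ℝ} (hN : 1 ≤ N) {D I : Finset ℤ} {g : ℤ → ℤ}
    (hI : IsIncrement N I g) (hD : (D.card : ℝ) ≤ τ * N) :
    mean I (fun y => if g y ∈ D then 1 else 0) ≤ τ := by
  have hNI : (N : ℝ) ≤ I.card := by exact_mod_cast hI.card_le
  have hN0 : (0 : ℝ) < N := by exact_mod_cast hN
  have hτ : 0 ≤ τ := by
    by_contra! h
    have := (Nat.cast_nonneg D.card).trans hD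
    nlinarith
  rw [mean_indicator, div_le_iff₀ (hN0.trans_le hNI)]
  have : (I.filter fun y => g y ∈ D).card ≤ D.card :=
    Finset.card_le_card_of_injOn g (fun y hy => (Finset.mem_filter.1 hy).2) hI.inj.injOn
  calc ((I.filter fun y => g y ∈ D).card : ℝ) ≤ D.card := by exact_mod_cast this
    _ ≤ τ * N := hD
    _ ≤ τ * I.card := by gcongr

theorem cubeProb_le_of_card_le {N : ℕ} {τ : ℝ} (hN : 1 ≤ N) (hτ : 0 ≤ τ)
    {M : List (Finset ℤ × (ℤ → ℤ))} (hM : ∀ m ∈ M, IsIncrement N m.1 m.2) {D : Finset ℤ}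
    (hD : (D.card : ℝ) ≤ τ * N) : cubeProb D M ≤ τ ^ M.length := by
  induction M generalizing D with
  | nil =>
    simp only [cubeProb, List.map_nil, expect, List.length_nil, pow_zero]
    split_ifs <;> norm_num
  | cons m M ih =>
    rw [cubeProb_cons, List.length_cons, pow_succ]
    have hM' : ∀ m ∈ M, IsIncrement N m.1 m.2 := fun m hm => hM m (List.mem_cons_of_mem _ hm)
    calc _ ≤ mean m.1 fun y => τ ^ M.length * (if m.2 y ∈ D then 1 else 0) := by
          refine mean_mono fun y _ => ?_
          split_ifs with h
          · rw [mul_one]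
            refine ih hM' (le_trans ?_ hD)
            exact_mod_cast Finset.card_filter_le _ _
          · rw [cubeProb_cons_eq_zero h, mul_zero]
      _ ≤ τ ^ M.length * τ := by
          rw [mean_const_mul]
          exact mul_le_mul_of_nonneg_left
            (mean_indicator_mem_le hN (hM m List.mem_cons_self) hD) (by positivity)

/-- The probability that a random cube lies in a sparse set `D` with small boundary.  As long as the
set of surviving base points is large, a generator either has small loss, which has probability at
most `τ`, or it shrinks that set by the factor `1 - τ / 30`, which happens at most `j` times. -/
theorem cubeProb_le {N : ℕ} {τ : ℝ} (hN : 1 ≤ N) (hτ : 0 < τ) (hτ1 : τ ≤ 1)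
    {M : List (Finset ℤ × (ℤ → ℤ))} (hM : ∀ m ∈ M, IsIncrement N m.1 m.2) (j : ℕ) {D : Finset ℤ}
    (hsparse : ∀ z : ℤ, (((Finset.range N).filter fun j : ℕ => z + j ∈ D).card : ℝ) ≤ N / 4)
    (h1 : (loss D 1 : ℝ) * 2 ^ M.length ≤ τ / 30 * (τ * N))
    (hD : (D.card : ℝ) * (1 - τ / 30) ^ j ≤ τ * N) :
    cubeProb D M ≤ (2 * τ) ^ M.length / τ ^ j := by
  have hτj : ∀ j : ℕ, τ ^ j ≤ 1 := fun j => pow_le_one₀ hτ.le hτ1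
  have hN0 : (0 : ℝ) < N := by exact_mod_cast hN
  induction M generalizing D j with
  | nil =>
    simp only [cubeProb, List.map_nil, expect, List.length_nil, pow_zero]
    have : 1 ≤ 1 / τ ^ j := one_le_one_div (by positivity) (hτj j)
    split_ifs
    · exact this
    · linarith
  | cons m M ih =>
    by_cases hcard : (D.card : ℝ) ≤ τ * N
    · refine (cubeProb_le_of_card_le hN hτ.le hM hcard).trans ?_
      calc τ ^ (m :: M).length ≤ (2 * τ) ^ (m :: M).length := by
            gcongr; linarith
        _ ≤ _ := le_div_self (by positivity) (by positivity) (hτj j)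
    push Not at hcard
    obtain _ | j := j
    · simp only [pow_zero, mul_one] at hD
      linarith
    have hDne : D.Nonempty := Finset.card_pos.1 (by
      have : (0 : ℝ) < D.card := (by positivity : 0 < τ * N).trans hcard
      exact_mod_cast this)
    have hM' : ∀ m ∈ M, IsIncrement N m.1 m.2 := fun m hm => hM m (List.mem_cons_of_mem _ hm)
    have hm := hM m List.mem_cons_self
    rw [List.length_cons, pow_succ] at h1
    set D' : ℤ → Finset ℤ := fun d => D.filter fun z => z + d ∈ D with hD'
    have hsub : ∀ d, D' d ⊆ D := fun d => Finset.filter_subset _ _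
    have hsparse' : ∀ d, ∀ z : ℤ,
        (((Finset.range N).filter fun j : ℕ => z + j ∈ D' d).card : ℝ) ≤ N / 4 := by
      intro d z
      refine le_trans ?_ (hsparse z)
      exact_mod_cast Finset.card_le_card
        (Finset.monotone_filter_right _ fun j _ hj => hsub d hj)
    have h1' : ∀ d, (loss (D' d) 1 : ℝ) * 2 ^ M.length ≤ τ / 30 * (τ * N) := by
      intro d
      have : (loss (D' d) 1 : ℝ) ≤ 2 * loss D 1 := by exact_mod_cast loss_filter_le D d 1
      refine le_trans ?_ h1
      calc _ ≤ 2 * (loss D 1 : ℝ) * 2 ^ M.length := by gcongr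
        _ = _ := by ring
    have hcle : ∀ d, ((D' d).card : ℝ) ≤ D.card := fun d => by
      exact_mod_cast Finset.card_le_card (hsub d)
    have hs0 : 0 ≤ 1 - τ / 30 := by linarith
    set b := (2 * τ) ^ M.length / τ ^ (j + 1) with hb
    have hb0 : 0 ≤ b := by positivity
    have hbj : (2 * τ) ^ M.length / τ ^ j = b * τ := by
      rw [hb, pow_succ]
      field_simp
    rw [cubeProb_cons]
    calc _ ≤ mean m.1 fun y =>
          b * (if (loss D (m.2 y) : ℝ) ≤ τ / 30 * D.card then 1 else 0) + b * τ := by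
          refine mean_mono fun y _ => ?_
          split_ifs with hloss
          · have := ih hM' (j + 1) (hsparse' (m.2 y)) (h1' _)
              ((mul_le_mul_of_nonneg_right (hcle _) (by positivity)).trans hD)
            have : 0 ≤ b * τ := by positivity
            linarith
          · rw [mul_zero, zero_add, ← hbj]
            refine ih hM' j (hsparse' (m.2 y)) (h1' _) (le_trans ?_ hD)
            have : ((D' (m.2 y)).card : ℝ) + loss D (m.2 y) = D.card := by
              exact_mod_cast card_filter_add_mem_add_loss D (m.2 y)
            rw [pow_succ', ← mul_assoc]
            gcongr
            linarith
      _ = b * mean m.1 (fun y => if (loss D (m.2 y) : ℝ) ≤ τ / 30 * D.card then 1 else 0) +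
            b * τ := by
          rw [← mean_const_mul]
          have hne : m.1.Nonempty := Finset.card_pos.1 (hN.trans hm.card_le)
          have := mean_const hne (b * τ)
          simp only [mean, Finset.sum_add_distrib, add_div] at this ⊢
          rw [this]
      _ ≤ b * τ + b * τ := by
          gcongr
          obtain ⟨c, hc⟩ := hm.range
          have hNI : (N : ℝ) ≤ m.1.card := by exact_mod_cast hm.card_le
          rw [mean_indicator, div_le_iff₀ (hN0.trans_le hNI)]
          have h2 : (loss D 1 : ℝ) ≤ τ / 30 * D.card := by
            have : (1 : ℝ) ≤ 2 ^ M.length * 2 := by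
              have := one_le_pow₀ (by norm_num : (1 : ℝ) ≤ 2) (n := M.length)
              linarith
            calc (loss D 1 : ℝ) ≤ loss D 1 * (2 ^ M.length * 2) :=
                  le_mul_of_one_le_right (Nat.cast_nonneg _) this
              _ ≤ τ / 30 * (τ * N) := h1
              _ ≤ _ := by gcongr
          have := card_small_loss_le (I := m.1.image m.2) hτ hN hsparse hDne h2 (c := c)
            (fun z hz => by
              obtain ⟨y, hy, rfl⟩ := Finset.mem_image.1 hz
              exact hc y hy)
            (by rw [Finset.card_image_of_injective _ hm.inj]; exact hm.card_le)
          rw [Finset.filter_image, Finset.card_image_of_injective _ hm.inj,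
            Finset.card_image_of_injective _ hm.inj] at this
          exact this
      _ = (2 * τ) ^ (M.length + 1) / τ ^ (j + 1) := by rw [hb]; ring

/-! ### Truncated power sums -/

/-- Probability densities on `ℤ` with mass at most `μ` in every window of length `N`, which vary at
most by a factor `2` on the scale `H`. -/
structure Spread (N H : ℕ) (μ : ℝ) (f : ℤ → ℝ) : Prop where
  nonneg : ∀ t, 0 ≤ f t
  hasSum : HasSum f 1
  le_two_mul : ∀ t t', |t - t'| ≤ (H : ℤ) → f t' ≤ 2 * f t
  window_le : ∀ t : ℤ, ∑ j ∈ Finset.range N, f (t + j) ≤ μ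

theorem hasSum_step {p : ℝ} {x : ℤ} {f : ℤ → ℝ} (hf : HasSum f 1) : HasSum (step p x f) 1 := by
  have := (hf.mul_left (1 - p)).add (((Equiv.addRight x).hasSum_iff.2 hf).mul_left p)
  rwa [show (1 - p) * 1 + p * 1 = (1 : ℝ) by ring] at this

theorem hasSum_avg {p : ℝ} {xs : List ℤ} {f : ℤ → ℝ} (hf : HasSum f 1) :
    HasSum (avg p xs f) 1 := by
  induction xs generalizing f with
  | nil => exact hf
  | cons x xs ih => exact ih (hasSum_step hf)

theorem avg_le_two_mul {p : ℝ} (hp : 0 ≤ p) (hp1 : p ≤ 1) (xs : List ℤ) {H : ℕ} {f : ℤ → ℝ}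
    (h : ∀ t t', |t - t'| ≤ (H : ℤ) → f t' ≤ 2 * f t) :
    ∀ t t', |t - t'| ≤ (H : ℤ) → avg p xs f t' ≤ 2 * avg p xs f t := by
  induction xs generalizing f with
  | nil => exact h
  | cons x xs ih =>
    refine ih fun t t' htt' => ?_
    have h1 := h t t' htt'
    have h2 := h (t + x) (t' + x) (by rwa [add_sub_add_right_eq_sub])
    simp only [step]
    nlinarith

theorem Spread.avg {N H : ℕ} {μ : ℝ} {f : ℤ → ℝ} (hf : Spread N H μ f) {p : ℝ} (hp : 0 ≤ p)
    (hp1 : p ≤ 1) (xs : List ℤ) : Spread N H μ (avg p xs f) where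
  nonneg := le_avg hp hp1 xs hf.nonneg
  hasSum := hasSum_avg hf.hasSum
  le_two_mul := avg_le_two_mul hp hp1 xs hf.le_two_mul
  window_le := by
    induction xs generalizing f with
    | nil => exact hf.window_le
    | cons x xs ih =>
      refine ih ⟨le_avg hp hp1 [x] hf.nonneg, hasSum_step hf.hasSum,
        avg_le_two_mul hp hp1 [x] hf.le_two_mul, fun t => ?_⟩
      have h1 := hf.window_le t
      have h2 := hf.window_le (t + x)
      simp only [step, Finset.sum_add_distrib, ← Finset.mul_sum, add_right_comm t _ x]
      nlinarith

theorem Spread.le_one {N H : ℕ} {μ : ℝ} {f : ℤ → ℝ} (hf : Spread N H μ f) (t : ℤ) : f t ≤ 1 :=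
  le_hasSum hf.hasSum t fun s _ => hf.nonneg s

theorem Spread.card_mul_le {N H : ℕ} {μ : ℝ} {f : ℤ → ℝ} (hf : Spread N H μ f) {S : Finset ℤ}
    {c : ℤ} (hS : S ⊆ Finset.Ico c (c + N)) {a : ℝ} (ha : ∀ x ∈ S, a ≤ f x) :
    S.card * a ≤ μ := by
  have hinj : Function.Injective fun j : ℕ => c + (j : ℤ) := fun a b h => by simpa using h
  have h1 : S ⊆ (Finset.range N).image fun j : ℕ => c + (j : ℤ) := by
    intro x hx
    have := Finset.mem_Ico.1 (hS hx)
    exact Finset.mem_image.2 ⟨(x - c).toNat, by rw [Finset.mem_range]; omega, by omega⟩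
  calc S.card * a = ∑ _x ∈ S, a := by rw [Finset.sum_const, nsmul_eq_mul]
    _ ≤ ∑ x ∈ S, f x := Finset.sum_le_sum ha
    _ ≤ ∑ x ∈ (Finset.range N).image fun j : ℕ => c + (j : ℤ), f x :=
        Finset.sum_le_sum_of_subset_of_nonneg h1 fun x _ _ => hf.nonneg x
    _ = ∑ j ∈ Finset.range N, f (c + j) := Finset.sum_image hinj.injOn
    _ ≤ μ := hf.window_le c

/-- A window of length `2 N` consists of two windows of length `N`. -/
theorem Spread.card_mul_le_two_mul {N H : ℕ} {μ : ℝ} {f : ℤ → ℝ} (hf : Spread N H μ f)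
    {S : Finset ℤ} {c : ℤ} (hS : S ⊆ Finset.Ico c (c + 2 * N)) {a : ℝ} (ha : ∀ x ∈ S, a ≤ f x) :
    S.card * a ≤ 2 * μ := by
  have h1 := hf.card_mul_le (S := S.filter (· < c + N)) (c := c) (fun x hx => by
    rw [Finset.mem_filter] at hx
    have := Finset.mem_Ico.1 (hS hx.1)
    rw [Finset.mem_Ico]; omega) fun x hx => ha x (Finset.mem_filter.1 hx).1
  have h2 := hf.card_mul_le (S := S.filter (¬ · < c + N)) (c := c + N) (fun x hx => by
    rw [Finset.mem_filter] at hx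
    have := Finset.mem_Ico.1 (hS hx.1)
    rw [Finset.mem_Ico]; omega) fun x hx => ha x (Finset.mem_filter.1 hx).1
  have h3 : ((S.filter (· < c + N)).card : ℝ) + (S.filter (¬ · < c + N)).card = S.card := by
    exact_mod_cast Finset.card_filter_add_card_filter_not _
  rw [← h3]
  linarith

/-- The `q`-th power, truncated below the level `θ`. -/
noncomputable def truncPow (θ : ℝ) (q : ℕ) (u : ℝ) : ℝ := if θ ≤ u then u ^ q else 0

/-- The sum of the `q`-th powers of the values of `f` that are at least `θ`. -/
noncomputable def powSum (θ : ℝ) (q : ℕ) (f : ℤ → ℝ) : ℝ := ∑' t, truncPow θ q (f t)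

theorem truncPow_nonneg {θ : ℝ} {q : ℕ} {u : ℝ} (hu : 0 ≤ u) : 0 ≤ truncPow θ q u := by
  unfold truncPow; split_ifs <;> positivity

theorem truncPow_le_self {θ : ℝ} {q : ℕ} (hq : 1 ≤ q) {u : ℝ} (hu : 0 ≤ u) (hu1 : u ≤ 1) :
    truncPow θ q u ≤ u := by
  unfold truncPow
  split_ifs
  · exact pow_le_of_le_one hu hu1 (by omega)
  · exact hu

theorem truncPow_le_mul {θ : ℝ} {q : ℕ} {u v ρ : ℝ} (hu : 0 ≤ u) (hv : 0 ≤ v) (hρ : 0 ≤ ρ)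
    (hρ1 : ρ ≤ 1) (h : u ≤ ρ * v) : truncPow θ q u ≤ ρ ^ q * truncPow θ q v := by
  by_cases hθ : θ ≤ u
  · rw [truncPow, if_pos hθ, truncPow,
      if_pos (hθ.trans (h.trans (mul_le_of_le_one_left hv hρ1))), ← mul_pow]
    exact pow_le_pow_left₀ hu h q
  · rw [truncPow, if_neg hθ]
    exact mul_nonneg (by positivity) (truncPow_nonneg hv)

theorem truncPow_mono {θ : ℝ} {q : ℕ} {u v : ℝ} (hu : 0 ≤ u) (h : u ≤ v) :
    truncPow θ q u ≤ truncPow θ q v := by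
  simpa using
    truncPow_le_mul (θ := θ) (q := q) hu (hu.trans h) zero_le_one le_rfl (by simpa using h)

theorem Spread.summable_truncPow {N H : ℕ} {μ : ℝ} {f : ℤ → ℝ} (hf : Spread N H μ f) (θ : ℝ)
    {q : ℕ} (hq : 1 ≤ q) : Summable fun t => truncPow θ q (f t) :=
  Summable.of_nonneg_of_le (fun t => truncPow_nonneg (hf.nonneg t))
    (fun t => truncPow_le_self hq (hf.nonneg t) (hf.le_one t)) hf.hasSum.summable

theorem powSum_nonneg {θ : ℝ} {q : ℕ} {f : ℤ → ℝ} (hf : ∀ t, 0 ≤ f t) : 0 ≤ powSum θ q f :=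
  tsum_nonneg fun t => truncPow_nonneg (hf t)

theorem Spread.powSum_le_one {N H : ℕ} {μ : ℝ} {f : ℤ → ℝ} (hf : Spread N H μ f) (θ : ℝ)
    {q : ℕ} (hq : 1 ≤ q) : powSum θ q f ≤ 1 := by
  rw [← hf.hasSum.tsum_eq]
  exact Summable.tsum_le_tsum (fun t => truncPow_le_self hq (hf.nonneg t) (hf.le_one t))
    (hf.summable_truncPow θ hq) hf.hasSum.summable

/-- Values below `θ'` contribute little to a power sum, because the total mass is `1`. -/
theorem Spread.powSum_le_add {N H : ℕ} {μ : ℝ} {f : ℤ → ℝ} (hf : Spread N H μ f) (θ : ℝ) {θ' : ℝ}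
    (hθ' : 0 ≤ θ') {q : ℕ} : powSum θ (q + 1) f ≤ θ' ^ q + powSum θ' (q + 1) f := by
  have h : ∀ t, truncPow θ (q + 1) (f t) ≤ θ' ^ q * f t + truncPow θ' (q + 1) (f t) := by
    intro t
    have h0 := hf.nonneg t
    unfold truncPow
    split_ifs with h1 h2 h2
    · have : 0 ≤ θ' ^ q * f t := by positivity
      linarith
    · rw [add_zero, pow_succ]
      gcongr
      linarith
    · positivity
    · positivity
  have h2 := hf.summable_truncPow θ' (q := q + 1) (by omega)
  calc powSum θ (q + 1) f ≤ ∑' t, (θ' ^ q * f t + truncPow θ' (q + 1) (f t)) :=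
        Summable.tsum_le_tsum h (hf.summable_truncPow θ (by omega))
          ((hf.hasSum.summable.mul_left _).add h2)
    _ = _ := by
        rw [Summable.tsum_add (hf.hasSum.summable.mul_left _) h2, tsum_mul_left,
          hf.hasSum.tsum_eq, mul_one, powSum]

theorem Spread.pow_le_powSum {N H : ℕ} {μ : ℝ} {f : ℤ → ℝ} (hf : Spread N H μ f) {θ : ℝ}
    (hθ : 0 ≤ θ) {q : ℕ} (hq : 1 ≤ q) {t : ℤ} (ht : θ ≤ f t) : θ ^ q ≤ powSum θ q f := by
  refine le_trans ?_ ((hf.summable_truncPow θ hq).le_tsum t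
    fun s _ => truncPow_nonneg (hf.nonneg s))
  rw [truncPow, if_pos ht]
  exact pow_le_pow_left₀ hθ ht q

open Classical in
/-- The contraction principle for truncated power sums.  Suppose that each value `g xs t` of the
random function `g` is controlled by the value of `f` at one of finitely many shifted points
`s = t + a xs v`, with a gain `ρ` unless the event `B xs v s` occurs.  If all these events have
probability at most `β`, the expected power sum contracts by `|V| (ρ ^ q + β)`. -/
theorem expect_powSum_le {ι : Type*} (V : Finset ι) {L : List (Finset ℤ)}
    (hL : ∀ A ∈ L, A.Nonempty) (a : List ℤ → ι → ℤ) (B : List ℤ → ι → ℤ → Prop) {θ ρ β : ℝ} {q : ℕ}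
    (hρ : 0 ≤ ρ) {f : ℤ → ℝ} (hf0 : ∀ t, 0 ≤ f t) (hf : Summable fun t => truncPow θ q (f t))
    {g : List ℤ → ℤ → ℝ} (hg : ∀ xs, Summable fun t => truncPow θ q (g xs t))
    (h : ∀ xs, List.Forall₂ (· ∈ ·) xs L → ∀ t, ∃ v ∈ V, truncPow θ q (g xs t) ≤
      truncPow θ q (f (t + a xs v)) * (ρ ^ q + if B xs v (t + a xs v) then 1 else 0))
    (hβ : ∀ v ∈ V, ∀ s, θ ≤ f s → expect L (fun xs => if B xs v s then 1 else 0) ≤ β) :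
    expect L (fun xs => powSum θ q (g xs)) ≤ V.card * (ρ ^ q + β) * powSum θ q f := by
  set w : ℤ → ℝ := fun s => truncPow θ q (f s) with hw
  have hw0 : ∀ s, 0 ≤ w s := fun s => truncPow_nonneg (hf0 s)
  set κ : ι → List ℤ → ℤ → ℝ := fun v xs s => ρ ^ q + if B xs v s then 1 else 0 with hκ
  have hκ0 : ∀ v xs s, 0 ≤ κ v xs s := fun v xs s => by
    simp only [hκ]; split_ifs <;> positivity
  have hκC : ∀ v xs s, κ v xs s ≤ ρ ^ q + 1 := fun v xs s => by
    simp only [hκ]; split_ifs <;> simp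
  have hs : ∀ v xs, Summable fun s => w s * κ v xs s := fun v xs =>
    Summable.of_nonneg_of_le (fun s => mul_nonneg (hw0 s) (hκ0 v xs s))
      (fun s => mul_le_mul_of_nonneg_left (hκC v xs s) (hw0 s)) (hf.mul_right _)
  have hpt : ∀ xs, List.Forall₂ (· ∈ ·) xs L →
      powSum θ q (g xs) ≤ ∑ v ∈ V, ∑' s, w s * κ v xs s := by
    intro xs hxs
    have hs' : ∀ v, HasSum (fun t => w (t + a xs v) * κ v xs (t + a xs v))
        (∑' s, w s * κ v xs s) := fun v =>
      (Equiv.addRight (a xs v)).hasSum_iff.2 (hs v xs).hasSum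
    refine hasSum_le (fun t => ?_) (hg xs).hasSum (hasSum_sum fun v (_ : v ∈ V) => hs' v)
    obtain ⟨v, hv, hle⟩ := h xs hxs t
    exact hle.trans (Finset.single_le_sum
      (f := fun v => w (t + a xs v) * κ v xs (t + a xs v))
      (fun v _ => mul_nonneg (hw0 _) (hκ0 v xs _)) hv)
  refine (expect_mono hpt).trans ?_
  rw [expect_sum, mul_assoc, ← nsmul_eq_mul, ← Finset.sum_const]
  refine Finset.sum_le_sum fun v hv => expect_tsum_le hf hw0 (hκ0 v) (hκC v) fun s hws => ?_
  have hθ : θ ≤ f s := by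
    by_contra hθ
    exact hws (by simp only [hw, truncPow, if_neg hθ])
  rw [expect_add, expect_const hL]
  exact add_le_add_right (hβ v hv s hθ) _

/-- The integer interval with left end `q.1` and length `q.2`. -/
noncomputable def piece (q : ℤ × ℕ) : Finset ℤ := Finset.Ico q.1 (q.1 + q.2)

theorem card_piece (q : ℤ × ℕ) : (piece q).card = q.2 := by
  simp [piece]

/-- One step with a random increment: unless the increment hits the set where `f` is comparable to
the larger one of the two averaged values, the average is smaller by the factor
`1 - p + p r` than that value. -/
theorem mean_powSum_step_le {N H : ℕ} (hN : 1 ≤ N) {μ : ℝ} {f : ℤ → ℝ} (hf : Spread N H μ f)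
    {p r θ : ℝ} (hp : 0 ≤ p) (hp2 : p ≤ 1 / 2) (hr : 0 < r) (hr1 : r ≤ 1) (hθ : 0 < θ)
    {q : ℕ} (hq : 1 ≤ q) {u : ℤ × ℕ} (hu : N ≤ u.2) (hu2 : u.2 ≤ 2 * N) :
    mean (piece u) (fun x => powSum θ q (step p x f)) ≤
      2 * ((1 - p + p * r) ^ q + 2 * μ / (N * (r * θ))) * powSum θ q f := by
  classical
  have hp1 : p ≤ 1 := by linarith
  have hN0 : (0 : ℝ) < N := by exact_mod_cast hN
  have hρ : 0 ≤ 1 - p + p * r := by nlinarith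
  have hρ1 : 1 - p + p * r ≤ 1 := by nlinarith
  have hne : (piece u).Nonempty := Finset.card_pos.1 (by rw [card_piece]; omega)
  have hcardN : (N : ℝ) ≤ (piece u).card := by rw [card_piece]; exact_mod_cast hu
  have := expect_powSum_le (Finset.univ : Finset Bool) (L := [piece u]) (by simpa using hne)
    (fun xs v => if v then xs.sum else 0)
    (fun xs v s => r * f s ≤ f (s + if v then -xs.sum else xs.sum)) (β := 2 * μ / (N * (r * θ)))
    hρ hf.nonneg (hf.summable_truncPow θ hq) (g := fun xs => avg p xs f)
    (fun xs => (hf.avg hp hp1 xs).summable_truncPow θ hq) ?_ ?_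
  · simpa [expect, avg] using this
  · intro xs hxs t
    obtain ⟨x, rfl⟩ : ∃ x, xs = [x] := by
      obtain _ | ⟨_, h⟩ := hxs
      cases h
      exact ⟨_, rfl⟩
    have hg0 := le_avg hp hp1 [x] hf.nonneg t
    have h0 := hf.nonneg t
    have h1 := hf.nonneg (t + x)
    have hg : avg p [x] f t = (1 - p) * f t + p * f (t + x) := rfl
    rcases le_total (f (t + x)) (f t) with h | h
    · refine ⟨false, Finset.mem_univ _, ?_⟩
      simp only [Bool.false_eq_true, if_false, add_zero, List.sum_singleton]
      rw [mul_comm]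
      split_ifs with hB
      · refine (truncPow_mono hg0 (by rw [hg]; nlinarith)).trans
          (le_mul_of_one_le_left (truncPow_nonneg h0) ?_)
        have := pow_nonneg hρ q
        linarith
      · rw [add_zero]
        refine truncPow_le_mul hg0 h0 hρ hρ1 ?_
        push Not at hB
        rw [hg]; nlinarith
    · refine ⟨true, Finset.mem_univ _, ?_⟩
      simp only [if_true, List.sum_singleton, add_neg_cancel_right]
      rw [mul_comm]
      split_ifs with hB
      · refine (truncPow_mono hg0 (by rw [hg]; nlinarith)).trans
          (le_mul_of_one_le_left (truncPow_nonneg h1) ?_)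
        have := pow_nonneg hρ q
        linarith
      · rw [add_zero]
        refine truncPow_le_mul hg0 h1 hρ hρ1 ?_
        push Not at hB
        have : 0 ≤ (1 - 2 * p) * ((1 - r) * f (t + x)) :=
          mul_nonneg (by linarith) (mul_nonneg (by linarith) h1)
        rw [hg]; nlinarith
  · intro v _ s hs
    simp only [expect, List.sum_singleton]
    rw [mean_indicator, div_le_div_iff₀ (hN0.trans_le hcardN) (by positivity)]
    have hrs : r * θ ≤ r * f s := by gcongr
    have key : (((piece u).filter fun x => r * f s ≤ f (s + if v then -x else x)).card : ℝ) *
        (r * f s) ≤ 2 * μ := by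
      set S := (piece u).filter fun x => r * f s ≤ f (s + if v then -x else x) with hS
      have hinj : Function.Injective fun x : ℤ => s + if v then -x else x := by
        intro x y hxy
        cases v <;> simpa using hxy
      rw [← Finset.card_image_of_injective S hinj]
      refine hf.card_mul_le_two_mul (c := if v then s - u.1 - u.2 + 1 else s + u.1) ?_ ?_
      · intro z hz
        obtain ⟨x, hx, rfl⟩ := Finset.mem_image.1 hz
        have := Finset.mem_Ico.1 (Finset.mem_filter.1 hx).1
        rw [Finset.mem_Ico]
        cases v
        · rw [if_neg Bool.false_ne_true, if_neg Bool.false_ne_true]; omega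
        · rw [if_pos rfl, if_pos rfl]; omega
      · intro z hz
        obtain ⟨x, hx, rfl⟩ := Finset.mem_image.1 hz
        exact (Finset.mem_filter.1 hx).2
    set c := (((piece u).filter fun x => r * f s ≤ f (s + if v then -x else x)).card : ℝ)
    have hc : 0 ≤ c := Nat.cast_nonneg _
    have hμ : 0 ≤ 2 * μ := (mul_nonneg hc (by nlinarith [mul_pos hr hθ])).trans key
    calc c * (N * (r * θ)) = (c * (r * θ)) * N := by ring
      _ ≤ (c * (r * f s)) * N :=
          mul_le_mul_of_nonneg_right (mul_le_mul_of_nonneg_left hrs hc) hN0.le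
      _ ≤ 2 * μ * N := mul_le_mul_of_nonneg_right key hN0.le
      _ ≤ 2 * μ * (piece u).card := mul_le_mul_of_nonneg_left hcardN hμ

/-! ### Blocks of pairs of increments -/

/-- Averaging over the pairs of increments listed in `l`. -/
noncomputable def pairAvg (p : ℝ) : List (ℤ × ℤ) → (ℤ → ℝ) → ℤ → ℝ
  | [], f => f
  | u :: l, f => step p u.1 (step p u.2 (pairAvg p l f))

theorem avg_append_eq_pairAvg (p : ℝ) {as ys : List ℤ} (h : as.length = ys.length) (f : ℤ → ℝ) :
    avg p (as ++ ys) f = pairAvg p (as.zip ys) f := by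
  induction as generalizing ys with
  | nil =>
    obtain rfl : ys = [] := List.length_eq_zero_iff.1 h.symm
    rfl
  | cons a as ih =>
    obtain _ | ⟨y, ys⟩ := ys
    · simp at h
    rw [List.cons_append, avg_cons', avg_append, avg_cons', ← avg_append,
      ih (by simpa using h)]
    rfl

/-- The contribution of one pair of increments to a shift, for given values of its two Bernoulli
variables. -/
def pairShift (b : Bool × Bool) (u : ℤ × ℤ) : ℤ :=
  (if b.1 then u.1 else 0) + (if b.2 then u.2 else 0)

/-- The shift by which the pairs listed in `l` move a point when the Bernoulli variables have the
values listed in `v`. -/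
def shift : List (Bool × Bool) → List (ℤ × ℤ) → ℤ
  | b :: v, u :: l => pairShift b u + shift v l
  | _, _ => 0

/-- The possible values of the Bernoulli variables that belong to `k` pairs of increments. -/
def choices : ℕ → Finset (List (Bool × Bool))
  | 0 => {[]}
  | k + 1 => (Finset.univ ×ˢ choices k).image fun u => u.1 :: u.2

theorem card_choices_le (k : ℕ) : (choices k).card ≤ 4 ^ k := by
  induction k with
  | zero => simp [choices]
  | succ k ih =>
    refine Finset.card_image_le.trans ?_
    rw [Finset.card_product, pow_succ']
    exact Nat.mul_le_mul (by simp) ih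

theorem cons_mem_choices {k : ℕ} (b : Bool × Bool) {v : List (Bool × Bool)} (hv : v ∈ choices k) :
    b :: v ∈ choices (k + 1) :=
  Finset.mem_image.2 ⟨(b, v), by simp [hv], rfl⟩

theorem exists_of_mem_choices_succ {k : ℕ} {v : List (Bool × Bool)} (hv : v ∈ choices (k + 1)) :
    ∃ b, ∃ w ∈ choices k, v = b :: w := by
  obtain ⟨⟨b, w⟩, h, rfl⟩ := Finset.mem_image.1 hv
  exact ⟨b, w, by simpa using h, rfl⟩

theorem choices_nonempty (k : ℕ) : (choices k).Nonempty := by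
  induction k with
  | zero => simp [choices]
  | succ k ih =>
    obtain ⟨v, hv⟩ := ih
    exact ⟨_, cons_mem_choices (true, true) hv⟩

/-- An average is smaller than the maximum of the averaged values by a definite fraction of the
deficit at any point. -/
theorem pairAvg_le_sub {p : ℝ} (hp : 0 ≤ p) (hp2 : p ≤ 1 / 2) (l : List (ℤ × ℤ)) {f : ℤ → ℝ}
    {M : ℝ} {t : ℤ} (hM : ∀ w ∈ choices l.length, f (t + shift w l) ≤ M)
    {v : List (Bool × Bool)} (hv : v ∈ choices l.length) :
    pairAvg p l f t ≤ M - p ^ (2 * l.length) * (M - f (t + shift v l)) := by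
  induction l generalizing t v with
  | nil =>
    have : v = [] := by simpa [choices] using hv
    subst this
    simp [pairAvg, shift]
  | cons u l ih =>
    obtain ⟨b, v, hv', rfl⟩ := exists_of_mem_choices_succ hv
    have hM' : ∀ c, ∀ w ∈ choices l.length, f (t + pairShift c u + shift w l) ≤ M := by
      intro c w hw
      have := hM (c :: w) (cons_mem_choices c hw)
      rwa [shift, ← add_assoc] at this
    have hle : ∀ c, pairAvg p l f (t + pairShift c u) ≤ M := by
      intro c
      have h1 := ih (hM' c) hv'
      have h2 := hM' c v hv'
      have := mul_nonneg (pow_nonneg hp (2 * l.length)) (sub_nonneg.2 h2)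
      linarith
    have hb := ih (hM' b) hv'
    rw [shift, ← add_assoc, List.length_cons]
    set δ := p ^ (2 * l.length) * (M - f (t + pairShift b u + shift v l)) with hδ
    have hδ0 : 0 ≤ δ := mul_nonneg (by positivity) (sub_nonneg.2 (hM' b v hv'))
    rw [show p ^ (2 * (l.length + 1)) * (M - f (t + pairShift b u + shift v l)) = p ^ 2 * δ by
      rw [hδ]; ring]
    have e : pairAvg p (u :: l) f t =
        (1 - p) ^ 2 * pairAvg p l f (t + pairShift (false, false) u) +
        (1 - p) * p * pairAvg p l f (t + pairShift (false, true) u) +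
        p * (1 - p) * pairAvg p l f (t + pairShift (true, false) u) +
        p ^ 2 * pairAvg p l f (t + pairShift (true, true) u) := by
      simp only [pairAvg, step, pairShift, if_true, Bool.false_eq_true, if_false, add_zero,
        zero_add, add_assoc]
      ring
    rw [e]
    set G : Bool × Bool → ℝ := fun c => pairAvg p l f (t + pairShift c u) with hG
    change (1 - p) ^ 2 * G (false, false) + (1 - p) * p * G (false, true) +
      p * (1 - p) * G (true, false) + p ^ 2 * G (true, true) ≤ M - p ^ 2 * δ
    -- each of the four weights is at least `p ^ 2`
    have w1 : p ^ 2 ≤ (1 - p) ^ 2 := by nlinarith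
    have w2 : p ^ 2 ≤ (1 - p) * p := by nlinarith
    have w3 : 0 ≤ p ^ 2 := by positivity
    have k : ∀ c, 0 ≤ M - G c := fun c => sub_nonneg.2 (hle c)
    have hb' : δ ≤ M - G b := by simp only [hG]; linarith
    have m1 := mul_le_mul_of_nonneg_right w1 (k (false, false))
    have m2 := mul_le_mul_of_nonneg_right w2 (k (false, true))
    have m3 := mul_le_mul_of_nonneg_right w2 (k (true, false))
    have n := fun c => mul_nonneg w3 (k c)
    have n1 := n (false, false)
    have n2 := n (false, true)
    have n3 := n (true, false)
    have n4 := n (true, true)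
    have hbb := mul_le_mul_of_nonneg_left hb' w3
    obtain ⟨b1, b2⟩ := b
    cases b1 <;> cases b2 <;> nlinarith

/-- Given the values of the two Bernoulli variables `b`, the two points that arise from a pair
`(a, y)` by using exactly one of its increments are, relative to the actual shift,
`pairBase b a` and `pairBase b a + pairIncr b a y`, in some order. -/
def pairBase (b : Bool × Bool) (a : ℤ) : ℤ :=
  if b.2 then (if b.1 then -a else 0) else (if b.1 then 0 else a)

/-- The difference between the two points described at `pairBase`: the generator that a pair
`(a, y)` contributes to the cube of reachable points. It is injective in `y`. -/
def pairIncr (b : Bool × Bool) (a y : ℤ) : ℤ := if b.2 then a - y else y - a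

/-- The sum of the base points `pairBase` over a list of pairs. -/
def cubeBase : List (Bool × Bool) → List ℤ → ℤ
  | b :: v, a :: as => pairBase b a + cubeBase v as
  | _, _ => 0

/-- The random generators that the second increments `y` of the pairs give rise to. -/
def generators : List (Bool × Bool) → List ℤ → List (Finset ℤ) → List (Finset ℤ × (ℤ → ℤ))
  | b :: v, a :: as, J :: Js => (J, pairIncr b a) :: generators v as Js
  | _, _, _ => []

theorem map_fst_generators {v : List (Bool × Bool)} {as : List ℤ} {Js : List (Finset ℤ)}
    (hv : v ∈ choices Js.length) (ha : as.length = Js.length) :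
    (generators v as Js).map Prod.fst = Js := by
  induction Js generalizing v as with
  | nil =>
    obtain rfl : v = [] := by simpa [choices] using hv
    rfl
  | cons J Js ih =>
    obtain ⟨b, v, hv', rfl⟩ := exists_of_mem_choices_succ hv
    obtain _ | ⟨a, as⟩ := as
    · simp at ha
    rw [generators, List.map_cons, ih hv' (by simpa using ha)]

/-- A pair `(a, y)` allows the four shifts `0`, `a`, `y`, `a + y`. Relative to the actual one, they
contain two points at distance `±(y - a)`, whatever the actual one is. So if `E` contains all the
points reachable by other choices, then it contains a cube with these differences as generators. -/
theorem hasCube_of_forall_choices {v : List (Bool × Bool)} {as ys : List ℤ}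
    {Js : List (Finset ℤ)} (hv : v ∈ choices Js.length) (ha : as.length = Js.length)
    (hy : ys.length = Js.length) {E : ℤ → Prop}
    (hE : ∀ w ∈ choices Js.length, E (shift w (as.zip ys) - shift v (as.zip ys))) :
    HasCube (fun z => E (z + cubeBase v as)) (increments (generators v as Js) ys) := by
  induction Js generalizing v as ys E with
  | nil =>
    obtain rfl : v = [] := by simpa [choices] using hv
    simpa [generators, increments, HasCube, cubeBase, shift, choices] using hE
  | cons J Js ih =>
    obtain ⟨b, v, hv', rfl⟩ := exists_of_mem_choices_succ hv
    obtain _ | ⟨a, as⟩ := as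
    · simp at ha
    obtain _ | ⟨y, ys⟩ := ys
    · simp at hy
    have key := ih hv' (by simpa using ha) (by simpa using hy)
      (E := fun z => E (z + pairBase b a) ∧ E (z + (pairBase b a + pairIncr b a y))) ?_
    · change HasCube (fun z => E (z + cubeBase (b :: v) (a :: as)) ∧
        E (z + pairIncr b a y + cubeBase (b :: v) (a :: as))) (increments (generators v as Js) ys)
      refine HasCube.mono (fun z hz => ?_) key
      rw [cubeBase]
      refine ⟨?_, ?_⟩
      · convert hz.1 using 1; ring
      · convert hz.2 using 1; ring
    · intro w hw
      have h : ∀ c, E (shift w (as.zip ys) - shift v (as.zip ys) +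
          (pairShift c (a, y) - pairShift b (a, y))) := by
        intro c
        have := hE (c :: w) (cons_mem_choices c hw)
        simp only [List.zip_cons_cons, shift] at this
        convert this using 1
        ring
      have h1 := h (true, false)
      have h2 := h (false, true)
      obtain ⟨b1, b2⟩ := b
      cases b1 <;> cases b2 <;>
        simp only [pairShift, pairBase, pairIncr, if_true, Bool.false_eq_true, if_false, add_zero,
          zero_add, sub_zero, sub_self] at h1 h2 ⊢
      · exact ⟨h1, by convert h2 using 2; ring⟩
      · exact ⟨h2, h1⟩
      · exact ⟨h1, h2⟩
      · exact ⟨by convert h2 using 2; ring, by convert h1 using 2; ring⟩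

/-- The points of a cube are bounded by the sum of the moduli of its generators. -/
theorem HasCube.of_bounded {ds : List ℤ} {E : ℤ → Prop} {G : ℤ} (hE : HasCube E ds)
    (hG : (ds.map abs).sum ≤ G) : HasCube (fun z => E z ∧ |z| ≤ G) ds := by
  induction ds generalizing E G with
  | nil => exact ⟨hE, by simpa using hG⟩
  | cons d ds ih =>
    rw [List.map_cons, List.sum_cons] at hG
    change HasCube (fun z => (E z ∧ |z| ≤ G) ∧ (E (z + d) ∧ |z + d| ≤ G)) ds
    refine HasCube.mono (fun z hz => ?_) (ih (E := fun z => E z ∧ E (z + d)) (G := G - |d|) hE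
      (by linarith))
    have h1 := abs_add_le z d
    have h2 := abs_nonneg d
    exact ⟨⟨hz.1.1, by linarith [hz.2]⟩, ⟨hz.1.2, by linarith [hz.2]⟩⟩

/-- The union of the cells `[k H, (k + 1) H)` that meet `E`, intersected with `[-G, G]`. -/
noncomputable def thicken (H : ℕ) (G : ℤ) (E : ℤ → Prop) : Finset ℤ :=
  open Classical in (Finset.Icc (-G) G).filter fun z => ∃ z', E z' ∧ z' / (H : ℤ) = z / (H : ℤ)

theorem mem_thicken {H : ℕ} {G : ℤ} {E : ℤ → Prop} {z : ℤ} :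
    z ∈ thicken H G E ↔ (-G ≤ z ∧ z ≤ G) ∧ ∃ z', E z' ∧ z' / (H : ℤ) = z / (H : ℤ) := by
  classical
  rw [thicken, Finset.mem_filter, Finset.mem_Icc]

theorem card_thicken_le {H : ℕ} {G : ℤ} (hG : 0 ≤ G) {E : ℤ → Prop} :
    ((thicken H G E).card : ℝ) ≤ 2 * G + 1 := by
  classical
  have h : (thicken H G E).card ≤ (Finset.Icc (-G) G).card := Finset.card_filter_le _ _
  rw [Int.card_Icc] at h
  have h2 : ((thicken H G E).card : ℤ) ≤ 2 * G + 1 := by omega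
  exact_mod_cast h2

/-- The boundary of a union of cells has at most about one point for each cell. -/
theorem loss_thicken_le {H : ℕ} (hH : 1 ≤ H) {G : ℤ} (hG : 0 ≤ G) {E : ℤ → Prop} :
    (loss (thicken H G E) 1 : ℝ) ≤ 2 * G / H + 3 := by
  have hH0 : (0 : ℤ) < H := by exact_mod_cast hH
  -- a boundary point is the last point of a cell or of `[-G, G]`
  have hsub : ((thicken H G E).filter fun z => z + 1 ∉ thicken H G E) ⊆
      insert G ((Finset.Icc (-G / (H : ℤ)) (G / (H : ℤ))).image
        fun k => (H : ℤ) * k + (H - 1)) := by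
    intro z hz
    rw [Finset.mem_filter, mem_thicken, mem_thicken] at hz
    obtain ⟨⟨⟨hz1, hz2⟩, z', hz', hzz⟩, hn⟩ := hz
    rw [Finset.mem_insert]
    by_cases hzG : z = G
    · exact Or.inl hzG
    right
    refine Finset.mem_image.2 ⟨z / H, ?_, ?_⟩
    · rw [Finset.mem_Icc]
      exact ⟨Int.ediv_le_ediv hH0 hz1, Int.ediv_le_ediv hH0 hz2⟩
    · have hne : (z + 1) / (H : ℤ) ≠ z / (H : ℤ) := by
        intro h
        exact hn ⟨⟨by omega, by omega⟩, z', hz', by rw [hzz, h]⟩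
      have h1 := Int.mul_ediv_add_emod z H
      have h2 := Int.emod_lt_of_pos z hH0
      have h3 := Int.emod_nonneg z hH0.ne'
      by_contra hcon
      apply hne
      rw [show z + 1 = (z % H + 1) + H * (z / H) by omega,
        Int.add_mul_ediv_left _ _ hH0.ne', Int.ediv_eq_zero_of_lt (by omega) (by omega), zero_add]
  have hcard : loss (thicken H G E) 1 ≤ (G / (H : ℤ) + 1 - -G / (H : ℤ)).toNat + 1 := by
    refine (Finset.card_le_card hsub).trans ((Finset.card_insert_le _ _).trans ?_)
    rw [← Int.card_Icc]
    exact Nat.add_le_add_right Finset.card_image_le 1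
  have h0 : -G / (H : ℤ) ≤ G / (H : ℤ) := Int.ediv_le_ediv hH0 (by omega)
  have hcard' : ((loss (thicken H G E) 1 : ℤ) : ℝ) ≤
      ((G / (H : ℤ) + 2 - -G / (H : ℤ) : ℤ) : ℝ) := by
    have : (loss (thicken H G E) 1 : ℤ) ≤ G / (H : ℤ) + 2 - -G / (H : ℤ) := by omega
    exact_mod_cast this
  have hHR : (0 : ℝ) < H := by exact_mod_cast hH
  have e1 : ((G / (H : ℤ) : ℤ) : ℝ) ≤ G / H := by
    rw [le_div_iff₀ hHR]
    exact_mod_cast Int.ediv_mul_le G hH0.ne'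
  have e2 : -(G : ℝ) / H - 1 ≤ ((-G / (H : ℤ) : ℤ) : ℝ) := by
    rw [sub_le_iff_le_add, div_le_iff₀ hHR]
    have := (Int.lt_ediv_add_one_mul_self (-G) hH0).le
    exact_mod_cast this
  push_cast at hcard'
  have e3 : -(G : ℝ) / H = -(G / H) := neg_div _ _
  have e4 : 2 * (G : ℝ) / H = 2 * (G / H) := mul_div_assoc _ _ _
  linarith

/-- A level set near a point of height at least `θ` is sparse because of the window bound, and so is
its thickening, on which `f` is smaller by at most another factor `2`. -/
theorem sparse_thicken {N H : ℕ} {μ : ℝ} {f : ℤ → ℝ} (hf : Spread N H μ f) (hH : 1 ≤ H)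
    {θ : ℝ} (hθ : 0 < θ) (hμθ : 16 * μ ≤ N * θ) {s : ℤ} (hs : θ ≤ f s) (G c z : ℤ) :
    (((Finset.range N).filter fun j : ℕ =>
      z + j ∈ thicken H G fun z => f s / 2 ≤ f (s + (z + c))).card : ℝ) ≤ N / 4 := by
  have hinj : Function.Injective fun j : ℕ => s + c + (z + (j : ℤ)) := fun a b h => by
    simpa using h
  have h1 := hf.card_mul_le (c := s + c + z) (a := f s / 4)
    (S := ((Finset.range N).filter fun j : ℕ =>
      z + j ∈ thicken H G fun z => f s / 2 ≤ f (s + (z + c))).image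
        fun j : ℕ => s + c + (z + (j : ℤ))) ?_ ?_
  · rw [Finset.card_image_of_injective _ hinj] at h1
    set m := (((Finset.range N).filter fun j : ℕ =>
      z + j ∈ thicken H G fun z => f s / 2 ≤ f (s + (z + c))).card : ℝ)
    have hm : 0 ≤ m := Nat.cast_nonneg _
    have h2 : m * (θ / 4) ≤ N * θ / 16 := by
      calc m * (θ / 4) ≤ m * (f s / 4) := by gcongr
        _ ≤ μ := h1
        _ ≤ _ := by linarith
    by_contra! hcon
    nlinarith [mul_lt_mul_of_pos_right hcon hθ]
  · intro x hx
    obtain ⟨j, hj, rfl⟩ := Finset.mem_image.1 hx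
    have := Finset.mem_range.1 (Finset.mem_filter.1 hj).1
    rw [Finset.mem_Ico]; omega
  · intro x hx
    obtain ⟨j, hj, rfl⟩ := Finset.mem_image.1 hx
    obtain ⟨-, z', hz', hzz⟩ := mem_thicken.1 (Finset.mem_filter.1 hj).2
    have hclose : |(s + c + (z + (j : ℤ))) - (s + (z' + c))| ≤ (H : ℤ) := by
      have hH0 : (0 : ℤ) < H := by exact_mod_cast hH
      have a1 := Int.mul_ediv_add_emod z' H
      have a2 := Int.emod_lt_of_pos z' hH0
      have a3 := Int.emod_nonneg z' hH0.ne'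
      have b1 := Int.mul_ediv_add_emod (z + j) H
      have b2 := Int.emod_lt_of_pos (z + j) hH0
      have b3 := Int.emod_nonneg (z + j) hH0.ne'
      rw [hzz] at a1
      rw [abs_le]
      constructor <;> omega
    have := hf.le_two_mul _ _ hclose
    linarith

/-- Two intervals of lengths between `N` and `2 N`, at distance `O(N)`. -/
structure IsClosePair (N : ℕ) (u : (ℤ × ℕ) × (ℤ × ℕ)) : Prop where
  le_fst : N ≤ u.1.2
  fst_le : u.1.2 ≤ 2 * N
  le_snd : N ≤ u.2.2
  snd_le : u.2.2 ≤ 2 * N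
  close : |u.1.1 - u.2.1| ≤ 16 * (N : ℤ)

theorem isIncrement_generators {N : ℕ} {P : List ((ℤ × ℕ) × (ℤ × ℕ))}
    (hP : ∀ u ∈ P, IsClosePair N u) {v : List (Bool × Bool)} {as : List ℤ}
    (hv : v ∈ choices P.length) (ha : as.length = P.length) :
    ∀ m ∈ generators v as (P.map fun u => piece u.2), IsIncrement N m.1 m.2 := by
  induction P generalizing v as with
  | nil =>
    obtain rfl : v = [] := by simpa [choices] using hv
    simp [generators]
  | cons u P ih =>
    obtain ⟨b, v, hv', rfl⟩ := exists_of_mem_choices_succ hv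
    obtain _ | ⟨a, as⟩ := as
    · simp at ha
    intro m hm
    rw [List.map_cons, generators, List.mem_cons] at hm
    rcases hm with rfl | hm
    · have hu := hP u List.mem_cons_self
      have h1 := hu.snd_le
      refine ⟨by rw [card_piece]; exact hu.le_snd, ?_, ?_⟩
      · intro y z hyz
        simp only [pairIncr] at hyz
        split_ifs at hyz <;> omega
      · obtain ⟨b1, b2⟩ := b
        cases b2
        · refine ⟨u.2.1 - a, fun y hy => ?_⟩
          have := Finset.mem_Ico.1 hy
          simp only [pairIncr, Bool.false_eq_true, if_false, Finset.mem_Ico]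
          omega
        · refine ⟨a - u.2.1 - 2 * N + 1, fun y hy => ?_⟩
          have := Finset.mem_Ico.1 hy
          simp only [pairIncr, if_true, Finset.mem_Ico]
          omega
    · exact ih (fun u hu => hP u (List.mem_cons_of_mem _ hu)) hv' (by simpa using ha) m hm

theorem sum_abs_increments_le {N : ℕ} {P : List ((ℤ × ℕ) × (ℤ × ℕ))}
    (hP : ∀ u ∈ P, IsClosePair N u) {v : List (Bool × Bool)} {as ys : List ℤ}
    (hv : v ∈ choices P.length) (ha : List.Forall₂ (· ∈ ·) as (P.map fun u => piece u.1))
    (hy : List.Forall₂ (· ∈ ·) ys (P.map fun u => piece u.2)) :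
    ((increments (generators v as (P.map fun u => piece u.2)) ys).map abs).sum ≤
      18 * N * P.length := by
  induction P generalizing v as ys with
  | nil =>
    obtain rfl : v = [] := by simpa [choices] using hv
    simp [generators, increments]
  | cons u P ih =>
    obtain ⟨b, v, hv', rfl⟩ := exists_of_mem_choices_succ hv
    rw [List.map_cons] at ha hy
    obtain _ | @⟨a, _, as, _, ha1, ha2⟩ := ha
    obtain _ | @⟨y, _, ys, _, hy1, hy2⟩ := hy
    have h := ih (fun u hu => hP u (List.mem_cons_of_mem _ hu)) hv' ha2 hy2
    simp only [List.map_cons, generators, increments, List.zipWith_cons_cons, List.sum_cons,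
      List.length_cons] at h ⊢
    have hb : |pairIncr b a y| ≤ 18 * N := by
      have hu := hP u List.mem_cons_self
      have h1 := Finset.mem_Ico.1 ha1
      have h2 := Finset.mem_Ico.1 hy1
      have h3 := abs_le.1 hu.close
      have h4 := hu.fst_le
      have h5 := hu.snd_le
      rw [pairIncr, abs_le]
      split_ifs <;> constructor <;> omega
    push_cast
    linarith

/-- The parameters of the block estimate: blocks of `2 j` pairs, the probability bound `τ` for a
single increment, and the scale `H` on which densities are nearly constant. By `card`, a set of at
most `74 j N` points that shrinks `j` times by the factor `1 - τ / 30` has at most `τ N` points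
left; by `boundary`, the boundary of a union of cells of length `H` stays negligible even though it
may double with each of the `2 j` generators. -/
structure BlockParams (j H : ℕ) (τ : ℝ) : Prop where
  j_pos : 1 ≤ j
  pos : 0 < τ
  le_one : τ ≤ 1
  card : 74 * (j : ℝ) * (1 - τ / 30) ^ j ≤ τ
  boundary : (72 * (j : ℝ) + 3) * 2 ^ (2 * j) ≤ τ / 30 * τ * H

theorem BlockParams.one_le {j H : ℕ} {τ : ℝ} (h : BlockParams j H τ) : 1 ≤ H := by
  by_contra! hH
  have : H = 0 := by omega
  have h2 := h.boundary
  rw [this, Nat.cast_zero, mul_zero] at h2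
  have : 0 < (72 * (j : ℝ) + 3) * 2 ^ (2 * j) := by positivity
  linarith

/-- `cubeProb_le` for the thickened level sets of a spread-out density. -/
theorem cubeProb_thicken_le {N H j : ℕ} {μ τ θ : ℝ} (hj : BlockParams j H τ) (hHN : H ≤ N)
    {f : ℤ → ℝ} (hf : Spread N H μ f) (hθ : 0 < θ) (hμθ : 16 * μ ≤ N * θ) {s : ℤ} (hs : θ ≤ f s)
    {M : List (Finset ℤ × (ℤ → ℤ))} (hM : ∀ m ∈ M, IsIncrement N m.1 m.2)
    (hMj : M.length = 2 * j) (c : ℤ) :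
    cubeProb (thicken H (18 * N * (2 * j : ℕ)) fun z => f s / 2 ≤ f (s + (z + c))) M ≤
      (4 * τ) ^ j := by
  have hH := hj.one_le
  have hN : 1 ≤ N := hH.trans hHN
  have hτ := hj.pos
  have hj1 : (1 : ℝ) ≤ j := by exact_mod_cast hj.j_pos
  have hN1 : (1 : ℝ) ≤ N := by exact_mod_cast hN
  have hHR : (0 : ℝ) < H := by exact_mod_cast hH
  have hHN' : (H : ℝ) ≤ N := by exact_mod_cast hHN
  set G : ℤ := 18 * N * (2 * j : ℕ) with hGdef
  have hG : 0 ≤ G := by positivity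
  have hGR : (G : ℝ) = 36 * (N * j) := by rw [hGdef]; push_cast; ring
  have hNj : 1 ≤ (N : ℝ) * j := by nlinarith
  have key := cubeProb_le hN hτ hj.le_one hM j (sparse_thicken hf hH hθ hμθ hs G c) ?_ ?_
  · refine key.trans_eq ?_
    rw [hMj, pow_mul, ← div_pow]
    congr 1
    field_simp
    norm_num
  · rw [hMj]
    have h1 := loss_thicken_le (E := fun z => f s / 2 ≤ f (s + (z + c))) hH hG
    have h2 : 2 * (G : ℝ) / H + 3 ≤ (72 * j + 3) * (N / H) := by
      have : 1 ≤ (N : ℝ) / H := (one_le_div hHR).2 hHN'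
      rw [hGR]
      calc 2 * (36 * ((N : ℝ) * j)) / H + 3 = 72 * j * (N / H) + 3 := by ring
        _ ≤ (72 * j + 3) * (N / H) := by linarith
    calc _ ≤ (72 * (j : ℝ) + 3) * (N / H) * 2 ^ (2 * j) := by
          gcongr
          exact h1.trans h2
      _ = ((72 * (j : ℝ) + 3) * 2 ^ (2 * j)) * (N / H) := by ring
      _ ≤ (τ / 30 * τ * H) * (N / H) := by
          exact mul_le_mul_of_nonneg_right hj.boundary (by positivity)
      _ = τ / 30 * (τ * N) := by field_simp
  · have h1 := card_thicken_le (H := H) (E := fun z => f s / 2 ≤ f (s + (z + c))) hG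
    have h2 : 2 * (G : ℝ) + 1 ≤ 74 * j * N := by rw [hGR]; nlinarith
    have h3 : 0 ≤ 1 - τ / 30 := by linarith [hj.le_one]
    calc _ ≤ 74 * (j : ℝ) * N * (1 - τ / 30) ^ j := by
          gcongr
          exact h1.trans h2
      _ = 74 * (j : ℝ) * (1 - τ / 30) ^ j * N := by ring
      _ ≤ τ * N := by
          gcongr
          exact hj.card

/-- The factor by which a block of `2 j` pairs contracts the expected power sum. -/
noncomputable def blockFactor (p τ : ℝ) (j q : ℕ) : ℝ :=
  4 ^ (2 * j) * ((1 - p ^ (2 * (2 * j)) / 2) ^ q + (4 * τ) ^ j)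

/-- The averaged value at a point is, unless all values on a cube are comparable, smaller by a
definite factor than the largest averaged value; and the cube lies in a level set with small
probability. -/
theorem expectAvg_block_le {N H j q : ℕ} {μ τ θ p : ℝ} (hp : 0 ≤ p) (hp2 : p ≤ 1 / 2)
    (hj : BlockParams j H τ) (hHN : H ≤ N) {f : ℤ → ℝ} (hf : Spread N H μ f) (hθ : 0 < θ)
    (hμθ : 16 * μ ≤ N * θ) (hq : 1 ≤ q) {P : List ((ℤ × ℕ) × (ℤ × ℕ))}
    (hP : ∀ u ∈ P, IsClosePair N u) (hPj : P.length = 2 * j) :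
    expectAvg p ((P.map fun u => piece u.1) ++ P.map fun u => piece u.2) (powSum θ q) f ≤
      blockFactor p τ j q * powSum θ q f := by
  classical
  have hN : 1 ≤ N := hj.one_le.trans hHN
  have hp1 : p ≤ 1 := by linarith
  have hpk : p ^ (2 * (2 * j)) ≤ 1 := pow_le_one₀ hp hp1
  have hpk0 : 0 ≤ p ^ (2 * (2 * j)) := by positivity
  have hρ : 0 ≤ 1 - p ^ (2 * (2 * j)) / 2 := by linarith
  have hρ1 : 1 - p ^ (2 * (2 * j)) / 2 ≤ 1 := by linarith
  have hne : ∀ q : ℤ × ℕ, N ≤ q.2 → (piece q).Nonempty := fun q hq =>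
    Finset.card_pos.1 (by rw [card_piece]; omega)
  have hIs : ∀ A ∈ P.map fun u => piece u.1, A.Nonempty := by
    intro A hA
    obtain ⟨u, hu, rfl⟩ := List.mem_map.1 hA
    exact hne _ (hP u hu).le_fst
  have hJs : ∀ A ∈ P.map fun u => piece u.2, A.Nonempty := by
    intro A hA
    obtain ⟨u, hu, rfl⟩ := List.mem_map.1 hA
    exact hne _ (hP u hu).le_snd
  have hτ := hj.pos
  rw [expectAvg, expect_append]
  -- only the second increments of the pairs are treated as random
  refine expect_le_of_le hIs fun as has => ?_
  have hal : as.length = P.length := by simpa using has.length_eq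
  have hΦ := powSum_nonneg (θ := θ) (q := q) hf.nonneg
  have key := expect_powSum_le (choices (2 * j)) hJs (fun ys v => shift v (as.zip ys))
    (fun ys v s => ∀ w ∈ choices (2 * j),
      f s / 2 ≤ f (s + (shift w (as.zip ys) - shift v (as.zip ys))))
    (β := (4 * τ) ^ j) hρ hf.nonneg (hf.summable_truncPow θ hq)
    (g := fun ys => avg p (as ++ ys) f)
    (fun ys => (hf.avg hp hp1 (as ++ ys)).summable_truncPow θ hq) ?_ ?_
  · refine key.trans ?_
    rw [blockFactor]
    gcongr
    exact_mod_cast card_choices_le (2 * j)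
  · intro ys hys t
    have hyl : ys.length = P.length := by simpa using hys.length_eq
    have hzl : (as.zip ys).length = 2 * j := by
      rw [List.length_zip, hal, hyl, min_self, hPj]
    obtain ⟨v, hv, hmax⟩ := (choices (2 * j)).exists_max_image
      (fun v => f (t + shift v (as.zip ys))) (choices_nonempty _)
    have hsub := fun w hw => pairAvg_le_sub hp hp2 (as.zip ys) (f := f) (t := t)
      (M := f (t + shift v (as.zip ys))) (by rw [hzl]; exact hmax) (v := w) (by rw [hzl]; exact hw)
    rw [hzl] at hsub
    have hg : avg p (as ++ ys) f t = pairAvg p (as.zip ys) f t := by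
      rw [avg_append_eq_pairAvg p (hal.trans hyl.symm)]
    have hg0 := le_avg hp hp1 (as ++ ys) hf.nonneg t
    have hM0 := hf.nonneg (t + shift v (as.zip ys))
    refine ⟨v, hv, ?_⟩
    simp only [add_assoc t, add_sub_cancel]
    rw [mul_comm]
    split_ifs with hB
    · refine (truncPow_mono hg0 ?_).trans (le_mul_of_one_le_left (truncPow_nonneg hM0) ?_)
      · rw [hg]
        simpa using hsub v hv
      · have := pow_nonneg hρ q
        linarith
    · push Not at hB
      obtain ⟨w, hw, hlt⟩ := hB
      rw [add_zero]
      refine truncPow_le_mul hg0 hM0 hρ hρ1 ?_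
      rw [hg]
      have h1 := hsub w hw
      nlinarith [mul_le_mul_of_nonneg_left hlt.le hpk0]
  · intro v hv s hs
    have hvP : v ∈ choices P.length := by rwa [hPj]
    have hvJ : v ∈ choices (P.map fun u => piece u.2).length := by rwa [List.length_map]
    have haJ : as.length = (P.map fun u => piece u.2).length := by rwa [List.length_map]
    have hfst := map_fst_generators hvJ haJ
    refine le_trans ?_ (cubeProb_thicken_le hj hHN hf hθ hμθ hs
      (isIncrement_generators hP hvP hal) ?_ (cubeBase v as))
    · rw [cubeProb, hfst]
      refine expect_mono fun ys hys => ?_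
      have hyJ : ys.length = (P.map fun u => piece u.2).length := hys.length_eq
      split_ifs with h1 h2 h2
      · exact le_rfl
      · exfalso
        apply h2
        have h3 := hasCube_of_forall_choices hvJ haJ hyJ (E := fun z => f s / 2 ≤ f (s + z))
          (by rwa [List.length_map, hPj])
        have h4 := sum_abs_increments_le hP hvP has hys
        rw [hPj] at h4
        refine HasCube.mono (fun z hz => ?_) (h3.of_bounded h4)
        exact mem_thicken.2 ⟨abs_le.1 hz.2, z, hz.1, rfl⟩
      · exact zero_le_one
      · exact le_rfl
    · rw [← List.length_map (f := Prod.fst), hfst, List.length_map, hPj]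

/-! ### Iterating the contraction -/

/-- The list of the intervals that occur in a list of pairs: the first ones, then the second
ones. -/
noncomputable def flatPairs (P : List ((ℤ × ℕ) × (ℤ × ℕ))) : List (Finset ℤ) :=
  (P.map fun u => piece u.1) ++ P.map fun u => piece u.2

theorem flatPairs_append_perm (P P' : List ((ℤ × ℕ) × (ℤ × ℕ))) :
    (flatPairs (P ++ P')).Perm (flatPairs P ++ flatPairs P') := by
  simp only [flatPairs, List.map_append, List.append_assoc]
  refine List.Perm.append_left _ ?_
  rw [← List.append_assoc, ← List.append_assoc]
  exact List.Perm.append_right _ List.perm_append_comm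

theorem blockFactor_nonneg {p τ : ℝ} (hp : 0 ≤ p) (hp1 : p ≤ 1) (hτ : 0 ≤ τ) (j q : ℕ) :
    0 ≤ blockFactor p τ j q := by
  have h : p ^ (2 * (2 * j)) ≤ 1 := pow_le_one₀ hp hp1
  have : 0 ≤ (1 - p ^ (2 * (2 * j)) / 2) ^ q := pow_nonneg (by linarith) q
  unfold blockFactor
  positivity

/-- The pairs are processed in `B` blocks of `2 j` pairs each. -/
theorem expectAvg_flatPairs_le {N H j q : ℕ} {μ τ θ p : ℝ} (hp : 0 ≤ p) (hp2 : p ≤ 1 / 2)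
    (hj : BlockParams j H τ) (hHN : H ≤ N) {f : ℤ → ℝ} (hf : Spread N H μ f) (hθ : 0 < θ)
    (hμθ : 16 * μ ≤ N * θ) (hq : 1 ≤ q) {P : List ((ℤ × ℕ) × (ℤ × ℕ))}
    (hP : ∀ u ∈ P, IsClosePair N u) {B : ℕ} (hPj : P.length = B * (2 * j)) :
    expectAvg p (flatPairs P) (powSum θ q) f ≤ blockFactor p τ j q ^ B * powSum θ q f := by
  have hγ := blockFactor_nonneg hp (by linarith) hj.pos.le j q
  induction B generalizing P with
  | zero =>
    obtain rfl : P = [] := List.length_eq_zero_iff.1 (by simpa using hPj)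
    simp [flatPairs, expectAvg, expect, avg]
  | succ B ih =>
    have hlen : 2 * j ≤ P.length := by rw [hPj]; nlinarith
    rw [← List.take_append_drop (2 * j) P, expectAvg_perm p (flatPairs_append_perm _ _),
      expectAvg_perm p List.perm_append_comm, expectAvg_append]
    refine (expect_mono fun xs _ => expectAvg_block_le hp hp2 hj hHN
      (hf.avg hp (by linarith) xs) hθ hμθ hq (fun u hu => hP u (List.mem_of_mem_take hu))
      (by rw [List.length_take, min_eq_left hlen])).trans ?_
    rw [expect_const_mul, pow_succ', mul_assoc]
    exact mul_le_mul_of_nonneg_left (ih (fun u hu => hP u (List.mem_of_mem_drop hu))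
      (by rw [List.length_drop, hPj]; ring_nf; omega)) hγ

theorem expectAvg_pieces_le {N H : ℕ} (hN : 1 ≤ N) {μ : ℝ} {f : ℤ → ℝ} (hf : Spread N H μ f)
    {p r θ : ℝ} (hp : 0 ≤ p) (hp2 : p ≤ 1 / 2) (hr : 0 < r) (hr1 : r ≤ 1) (hθ : 0 < θ)
    {q : ℕ} (hq : 1 ≤ q) {σ : ℝ} (hσ0 : 0 ≤ σ)
    (hσ : 2 * ((1 - p + p * r) ^ q + 2 * μ / (N * (r * θ))) ≤ σ) {Q : List (ℤ × ℕ)}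
    (hQ : ∀ u ∈ Q, N ≤ u.2 ∧ u.2 ≤ 2 * N) :
    expectAvg p (Q.map piece) (powSum θ q) f ≤ σ ^ Q.length * powSum θ q f := by
  induction Q generalizing f with
  | nil => simp [expectAvg, expect, avg]
  | cons u Q ih =>
    rw [List.map_cons, expectAvg_cons]
    calc _ ≤ mean (piece u) fun x => σ ^ Q.length * powSum θ q (step p x f) :=
          mean_mono fun x _ => ih (hf.avg hp (by linarith) [x])
            fun u hu => hQ u (List.mem_cons_of_mem _ hu)
      _ ≤ σ ^ Q.length * (σ * powSum θ q f) := by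
          rw [mean_const_mul]
          have hu := hQ u List.mem_cons_self
          gcongr
          refine (mean_powSum_step_le hN hf hp hp2 hr hr1 hθ hq hu.1 hu.2).trans ?_
          have := powSum_nonneg (θ := θ) (q := q) hf.nonneg
          gcongr
      _ = _ := by rw [List.length_cons, pow_succ, mul_assoc]

/-- The indicator function of the event that the sup norm exceeds `θ`. -/
noncomputable def supIndicator (θ : ℝ) (g : ℤ → ℝ) : ℝ :=
  open Classical in if θ < supNorm g then 1 else 0

theorem exists_lt_of_lt_supNorm {θ : ℝ} {g : ℤ → ℝ} (hg : ∀ t, 0 ≤ g t) (h : θ < supNorm g) :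
    ∃ t, θ < g t := by
  obtain ⟨t, ht⟩ := exists_lt_of_lt_ciSup h
  exact ⟨t, by rwa [abs_of_nonneg (hg t)] at ht⟩

theorem Spread.supIndicator_le {N H : ℕ} {μ : ℝ} {f : ℤ → ℝ} (hf : Spread N H μ f) {θ : ℝ}
    (hθ : 0 < θ) {q : ℕ} (hq : 1 ≤ q) : supIndicator θ f ≤ (θ ^ q)⁻¹ * powSum θ q f := by
  unfold supIndicator
  split_ifs with h
  · obtain ⟨t, ht⟩ := exists_lt_of_lt_supNorm hf.nonneg h
    rw [← div_eq_inv_mul, one_le_div (by positivity)]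
    exact hf.pow_le_powSum hθ.le hq ht.le
  · exact mul_nonneg (by positivity) (powSum_nonneg hf.nonneg)

/-- The large deviation bound for a spread-out density.  The single intervals `Q` bring the sup
norm down to the level `θ'`, the pairs `P` from there to the level `θ`. -/
theorem expectAvg_supIndicator_le {N H j q B : ℕ} {μ τ θ θ' p r σ : ℝ} (hp : 0 ≤ p)
    (hp2 : p ≤ 1 / 2) (hj : BlockParams j H τ) (hHN : H ≤ N) {f : ℤ → ℝ} (hf : Spread N H μ f)
    (hθ : 0 < θ) (hμθ : 16 * μ ≤ N * θ) (hr : 0 < r) (hr1 : r ≤ 1) (hθ' : 0 < θ') (hσ0 : 0 ≤ σ)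
    (hσ : 2 * ((1 - p + p * r) ^ (q + 1) + 2 * μ / (N * (r * θ'))) ≤ σ) {Q : List (ℤ × ℕ)}
    (hQ : ∀ u ∈ Q, N ≤ u.2 ∧ u.2 ≤ 2 * N) {P : List ((ℤ × ℕ) × (ℤ × ℕ))}
    (hP : ∀ u ∈ P, IsClosePair N u) (hPj : P.length = B * (2 * j)) :
    expectAvg p (Q.map piece ++ flatPairs P) (supIndicator θ) f ≤
      (θ ^ (q + 1))⁻¹ * (blockFactor p τ j (q + 1) ^ B * (θ' ^ q + σ ^ Q.length)) := by
  have hp1 : p ≤ 1 := by linarith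
  have hN : 1 ≤ N := hj.one_le.trans hHN
  have hγ := blockFactor_nonneg hp hp1 hj.pos.le j (q + 1)
  have hQne : ∀ A ∈ Q.map piece, A.Nonempty := by
    intro A hA
    obtain ⟨u, hu, rfl⟩ := List.mem_map.1 hA
    exact Finset.card_pos.1 (by rw [card_piece]; have := hQ u hu; omega)
  rw [expectAvg_append]
  calc _ ≤ expect (Q.map piece) fun xs => (θ ^ (q + 1))⁻¹ * (blockFactor p τ j (q + 1) ^ B *
        (θ' ^ q + powSum θ' (q + 1) (avg p xs f))) := by
        refine expect_mono fun xs _ => ?_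
        have hg := hf.avg hp hp1 xs
        calc _ ≤ expect (flatPairs P) fun ys =>
              (θ ^ (q + 1))⁻¹ * powSum θ (q + 1) (avg p ys (avg p xs f)) :=
              expect_mono fun ys _ => (hg.avg hp hp1 ys).supIndicator_le hθ (by omega)
          _ ≤ (θ ^ (q + 1))⁻¹ * (blockFactor p τ j (q + 1) ^ B *
              powSum θ (q + 1) (avg p xs f)) := by
              rw [expect_const_mul]
              gcongr
              exact expectAvg_flatPairs_le hp hp2 hj hHN hg hθ hμθ (by omega) hP hPj
          _ ≤ _ := by
              gcongr
              exact hg.powSum_le_add θ hθ'.le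
    _ = (θ ^ (q + 1))⁻¹ * (blockFactor p τ j (q + 1) ^ B *
        (θ' ^ q + expectAvg p (Q.map piece) (powSum θ' (q + 1)) f)) := by
        rw [expect_const_mul, expect_const_mul, expect_add, expect_const hQne]
        rfl
    _ ≤ _ := by
        gcongr
        refine (expectAvg_pieces_le hN hf hp hp2 hr hr1 hθ' (by omega) hσ0 hσ hQ).trans ?_
        exact mul_le_of_le_one_right (by positivity) (hf.powSum_le_one θ' (by omega))

/-! ### Reduction to increments that are uniform on intervals -/

theorem mean_le_iff {A : Finset ℤ} (hA : A.Nonempty) {F : ℤ → ℝ} {m : ℝ} :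
    mean A F ≤ m ↔ ∑ x ∈ A, F x ≤ m * A.card := by
  rw [mean, div_le_iff₀ (by exact_mod_cast hA.card_pos)]

theorem mean_union_le_max {A B : Finset ℤ} (hA : A.Nonempty) (hB : B.Nonempty) (h : Disjoint A B)
    (F : ℤ → ℝ) : mean (A ∪ B) F ≤ max (mean A F) (mean B F) := by
  have h1 := (mean_le_iff hA).1 (le_max_left (mean A F) (mean B F))
  have h2 := (mean_le_iff hB).1 (le_max_right (mean A F) (mean B F))
  rw [mean_le_iff (hA.mono Finset.subset_union_left), Finset.sum_union h,
    Finset.card_union_of_disjoint h]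
  push_cast
  linarith

/-- A mean over a long interval is at most the mean over one of its pieces of length in
`[N, 2 N]`. -/
theorem exists_piece_of_interval {N : ℕ} (hN : 1 ≤ N) (F : ℤ → ℝ) (l : ℕ) (c : ℤ) (hl : N ≤ l) :
    ∃ q : ℤ × ℕ, (N ≤ q.2 ∧ q.2 ≤ 2 * N) ∧ piece q ⊆ piece (c, l) ∧
      mean (piece (c, l)) F ≤ mean (piece q) F := by
  induction l using Nat.strong_induction_on generalizing c with
  | _ l ih =>
    by_cases h2 : l ≤ 2 * N
    · exact ⟨(c, l), ⟨hl, h2⟩, subset_rfl, le_rfl⟩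
    push Not at h2
    have hne : ∀ (c : ℤ) (k : ℕ), 1 ≤ k → (piece (c, k)).Nonempty := fun c k hk =>
      Finset.card_pos.1 (by rw [card_piece]; exact hk)
    have hunion : piece (c, l) = piece (c, N) ∪ piece (c + N, l - N) := by
      ext z
      simp only [piece, Finset.mem_union, Finset.mem_Ico]
      omega
    have hdisj : Disjoint (piece (c, N)) (piece (c + N, l - N)) := by
      rw [Finset.disjoint_left]
      intro z
      simp only [piece, Finset.mem_Ico]
      omega
    have hmax := mean_union_le_max (hne c N hN) (hne (c + N) (l - N) (by omega)) hdisj F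
    rw [← hunion] at hmax
    rcases le_max_iff.1 hmax with h | h
    · exact ⟨(c, N), ⟨le_rfl, by dsimp only; omega⟩,
        by rw [hunion]; exact Finset.subset_union_left, h⟩
    · obtain ⟨q, hq, hqs, hqm⟩ := ih (l - N) (by omega) (c + N) (by omega)
      exact ⟨q, hq, by rw [hunion]; exact hqs.trans Finset.subset_union_right, h.trans hqm⟩

theorem Icc_eq_piece (a b : ℤ) : Finset.Icc a b = piece (a, (b + 1 - a).toNat) := by
  ext z
  simp only [piece, Finset.mem_Icc, Finset.mem_Ico]
  omega

theorem card_Icc_eq (a b : ℤ) : (Finset.Icc a b).card = (b + 1 - a).toNat := Int.card_Icc a b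

/-- A symmetric union of two intervals that avoids `0` consists of an interval and its mirror image,
so that each of the two has at least `N` elements. -/
theorem exists_piece_of_union {N : ℕ} (hN : 1 ≤ N) {A I J : Finset ℤ} (hI : IsIntegerInterval I)
    (hJ : IsIntegerInterval J) (hA : A = I ∪ J) (hsymm : ∀ a ∈ A, -a ∈ A) (hcard : 2 * N ≤ A.card)
    (hdisj : Disjoint A (Finset.Icc (-(N : ℤ)) (N : ℤ))) (F : ℤ → ℝ) :
    ∃ q : ℤ × ℕ, (N ≤ q.2 ∧ q.2 ≤ 2 * N) ∧ piece q ⊆ A ∧ mean A F ≤ mean (piece q) F := by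
  obtain ⟨a, b, rfl⟩ := hI
  obtain ⟨c, d, rfl⟩ := hJ
  have hnot : ∀ z ∈ A, ¬ (-(N : ℤ) ≤ z ∧ z ≤ N) := fun z hz h =>
    Finset.disjoint_left.1 hdisj hz (Finset.mem_Icc.2 h)
  have hmem : ∀ z, z ∈ A ↔ (a ≤ z ∧ z ≤ b) ∨ (c ≤ z ∧ z ≤ d) := fun z => by
    rw [hA, Finset.mem_union, Finset.mem_Icc, Finset.mem_Icc]
  have hcu : A.card ≤ (b + 1 - a).toNat + (d + 1 - c).toNat := by
    rw [hA, ← card_Icc_eq, ← card_Icc_eq]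
    exact Finset.card_union_le _ _
  have h0 := hnot 0
  rw [hmem] at h0
  have hN' : (1 : ℤ) ≤ N := by exact_mod_cast hN
  -- the four endpoints and their negatives determine the shape of `A`
  have ha := hmem a
  have hb := hmem b
  have hc := hmem c
  have hd := hmem d
  have key : a ≤ b ∧ c ≤ d ∧ c = -b ∧ d = -a ∧ (0 < a ∨ b < 0) := by
    have sa := fun h => (hmem (-a)).1 (hsymm a h)
    have sb := fun h => (hmem (-b)).1 (hsymm b h)
    have sc := fun h => (hmem (-c)).1 (hsymm c h)
    have sd := fun h => (hmem (-d)).1 (hsymm d h)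
    rw [ha] at sa
    rw [hb] at sb
    rw [hc] at sc
    rw [hd] at sd
    omega
  obtain ⟨hab, hcd, rfl, rfl, hpos⟩ := key
  have hd' : Disjoint (Finset.Icc a b) (Finset.Icc (-b) (-a)) := by
    rw [Finset.disjoint_left]
    intro z
    rw [Finset.mem_Icc, Finset.mem_Icc]
    omega
  have hmax := mean_union_le_max (Finset.nonempty_Icc.2 hab) (Finset.nonempty_Icc.2 hcd) hd' F
  rw [← hA] at hmax
  rcases le_max_iff.1 hmax with h | h
  · obtain ⟨q, hq, hqs, hqm⟩ := exists_piece_of_interval hN F (b + 1 - a).toNat a (by omega)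
    rw [← Icc_eq_piece] at hqs hqm
    exact ⟨q, hq, by rw [hA]; exact hqs.trans Finset.subset_union_left, h.trans hqm⟩
  · obtain ⟨q, hq, hqs, hqm⟩ := exists_piece_of_interval hN F (-a + 1 - -b).toNat (-b) (by omega)
    rw [← Icc_eq_piece] at hqs hqm
    exact ⟨q, hq, by rw [hA]; exact hqs.trans Finset.subset_union_right, h.trans hqm⟩

theorem IsAdmissible.exists_piece {N n : ℕ} {K δ : ℝ} {A : Fin n → Finset ℤ}
    (hA : IsAdmissible N n K δ A) (hN : 1 ≤ N) (i : Fin n) (F : ℤ → ℝ) :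
    ∃ q : ℤ × ℕ, (N ≤ q.2 ∧ q.2 ≤ 2 * N) ∧ piece q ⊆ A i ∧ mean (A i) F ≤ mean (piece q) F := by
  rcases lt_or_ge (δ * n) ((i : ℕ) + 1 : ℝ) with h | h
  · obtain ⟨a, b, hab⟩ := hA.interval i h
    have hcard := hA.card_interval i h
    rw [hab, card_Icc_eq] at hcard
    rw [hab, Icc_eq_piece]
    exact exists_piece_of_interval hN F _ a (by omega)
  · obtain ⟨I, J, hI, hJ, hIJ⟩ := hA.union i h
    exact exists_piece_of_union hN hI hJ hIJ (hA.symm i) (hA.card_union i h) (hA.disjoint i h) F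

/-- Since the averaging operators commute, each set in an expectation may in turn be replaced by
the piece of it that is worst for the others. -/
theorem exists_pieces (p : ℝ) {good : Finset ℤ → ℤ × ℕ → Prop} {L : List (Finset ℤ)}
    (h : ∀ A ∈ L, ∀ F, ∃ q, good A q ∧ mean A F ≤ mean (piece q) F) (Φ : (ℤ → ℝ) → ℝ)
    (f : ℤ → ℝ) :
    ∃ Q : List (ℤ × ℕ), List.Forall₂ good L Q ∧
      expectAvg p L Φ f ≤ expectAvg p (Q.map piece) Φ f := by
  induction L generalizing Φ with
  | nil => exact ⟨[], .nil, le_rfl⟩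
  | cons A L ih =>
    obtain ⟨Q, hQ, hle⟩ := ih (fun B hB => h B (List.mem_cons_of_mem _ hB))
      (fun g => mean A fun x => Φ (step p x g))
    rw [← expectAvg_cons', ← expectAvg_cons', expectAvg_cons p A (Q.map piece)] at hle
    obtain ⟨q, hq, hq2⟩ := h A List.mem_cons_self
      fun x => expectAvg p (Q.map piece) Φ (step p x f)
    exact ⟨q :: Q, .cons hq hQ, hle.trans hq2⟩

theorem exists_perm_of_not_nodup_map {α β : Type*} (g : α → β) {l : List α}
    (h : ¬ (l.map g).Nodup) : ∃ a b l', l.Perm (a :: b :: l') ∧ g a = g b := by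
  induction l with
  | nil => simp at h
  | cons a l ih =>
    rw [List.map_cons, List.nodup_cons] at h
    by_cases ha : g a ∈ l.map g
    · obtain ⟨b, hb, hab⟩ := List.mem_map.1 ha
      obtain ⟨s, t, rfl⟩ := List.append_of_mem hb
      exact ⟨a, b, s ++ t, List.perm_middle.cons a, hab.symm⟩
    · obtain ⟨b, c, l', hl', hbc⟩ := ih fun hn => h ⟨ha, hn⟩
      refine ⟨b, c, a :: l', (hl'.cons a).trans ?_, hbc⟩
      exact (List.Perm.swap b a _).trans ((List.Perm.swap c a _).cons b)

/-- By the pigeonhole principle, a long list contains many disjoint pairs of entries of the same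
colour. -/
theorem exists_pairs {α : Type*} (g : α → ℤ) (S : Finset ℤ) (m : ℕ) {l : List α}
    (hS : ∀ a ∈ l, g a ∈ S) (hl : S.card + 2 * m ≤ l.length) :
    ∃ (P : List (α × α)) (l' : List α), l.Perm (P.map Prod.fst ++ P.map Prod.snd ++ l') ∧
      P.length = m ∧ ∀ u ∈ P, g u.1 = g u.2 := by
  induction m generalizing l with
  | zero => exact ⟨[], l, by simp, rfl, by simp⟩
  | succ m ih =>
    have hn : ¬ (l.map g).Nodup := by
      intro hn
      have h1 := List.toFinset_card_of_nodup hn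
      have h2 : (l.map g).toFinset ⊆ S := by
        intro z hz
        obtain ⟨a, ha, rfl⟩ := List.mem_map.1 (List.mem_toFinset.1 hz)
        exact hS a ha
      have h3 := Finset.card_le_card h2
      rw [h1, List.length_map] at h3
      omega
    obtain ⟨a, b, l₁, hl₁, hab⟩ := exists_perm_of_not_nodup_map g hn
    obtain ⟨P, l', hP, hPm, hPg⟩ := ih (l := l₁)
      (fun c hc => hS c (hl₁.mem_iff.2 (by simp [hc])))
      (by have := hl₁.length_eq; simp only [List.length_cons] at this; omega)
    refine ⟨(a, b) :: P, l', hl₁.trans ?_, by rw [List.length_cons, hPm], ?_⟩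
    · simp only [List.map_cons, List.cons_append]
      refine List.Perm.cons a ?_
      refine (List.Perm.cons b hP).trans ?_
      simp only [List.append_assoc, List.cons_append]
      exact List.perm_middle.symm
    · intro u hu
      rcases List.mem_cons.1 hu with rfl | hu
      exacts [hab, hPg u hu]

/-- Many of the intervals in a long list can be grouped into close pairs. -/
theorem exists_closePairs {N n m : ℕ} (hN : 1 ≤ N) {Q : List (ℤ × ℕ)}
    (hQ : ∀ q ∈ Q, N ≤ q.2 ∧ q.2 ≤ 2 * N) (hpos : ∀ q ∈ Q, |q.1| ≤ (n : ℤ) * N)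
    (hlen : n / 8 + 2 + 2 * m ≤ Q.length) :
    ∃ (P : List ((ℤ × ℕ) × (ℤ × ℕ))) (Q' : List (ℤ × ℕ)),
      (Q.map piece).Perm (Q'.map piece ++ flatPairs P) ∧ P.length = m ∧
      (∀ u ∈ P, IsClosePair N u) ∧ (∀ q ∈ Q', N ≤ q.2 ∧ q.2 ≤ 2 * N) ∧
      Q'.length + 2 * m = Q.length := by
  have hN0 : (0 : ℤ) < 16 * N := by omega
  -- the colour of an interval is the cell of length `16 N` that contains its left end
  obtain ⟨P, Q', hperm, hPm, hP⟩ := exists_pairs (fun q : ℤ × ℕ => q.1 / (16 * N))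
    (Finset.Icc (-((n / 16 : ℕ) : ℤ) - 1) (n / 16 : ℕ)) m (l := Q) (fun q hq => by
      have h := abs_le.1 (hpos q hq)
      have e : (n : ℤ) ≤ 16 * (n / 16 : ℕ) + 15 := by omega
      have e' : (n : ℤ) * N ≤ (16 * (n / 16 : ℕ) + 15) * N :=
        mul_le_mul_of_nonneg_right e (by positivity)
      have hN1 : (1 : ℤ) ≤ N := by exact_mod_cast hN
      rw [Finset.mem_Icc]
      constructor
      · rw [Int.le_ediv_iff_mul_le hN0]
        nlinarith
      · rw [← Int.lt_add_one_iff, Int.ediv_lt_iff_lt_mul hN0]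
        nlinarith) (by rw [Int.card_Icc]; omega)
  have hmemP : ∀ u ∈ P, u.1 ∈ Q ∧ u.2 ∈ Q := fun u hu =>
    ⟨hperm.mem_iff.2 (by
        simp only [List.mem_append, List.mem_map]
        exact Or.inl (Or.inl ⟨u, hu, rfl⟩)),
      hperm.mem_iff.2 (by
        simp only [List.mem_append, List.mem_map]
        exact Or.inl (Or.inr ⟨u, hu, rfl⟩))⟩
  refine ⟨P, Q', ?_, hPm, ?_, ?_, ?_⟩
  · refine (hperm.map piece).trans ?_
    simp only [List.map_append, flatPairs, List.map_map]
    exact List.perm_append_comm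
  · intro u hu
    have h1 := hQ _ (hmemP u hu).1
    have h2 := hQ _ (hmemP u hu).2
    refine ⟨h1.1, h1.2, h2.1, h2.2, ?_⟩
    have h := hP u hu
    have a1 := Int.mul_ediv_add_emod u.1.1 (16 * N)
    have a2 := Int.emod_lt_of_pos u.1.1 hN0
    have a3 := Int.emod_nonneg u.1.1 hN0.ne'
    have b1 := Int.mul_ediv_add_emod u.2.1 (16 * N)
    have b2 := Int.emod_lt_of_pos u.2.1 hN0
    have b3 := Int.emod_nonneg u.2.1 hN0.ne'
    beta_reduce at h
    rw [h] at a1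
    rw [abs_le]
    constructor <;> linarith
  · exact fun q hq => hQ q (hperm.mem_iff.2 (by simp [hq]))
  · have := hperm.length_eq
    simp only [List.length_append, List.length_map] at this
    omega

/-! ### From independent random variables to finite averages -/

theorem expect_ofFn {n : ℕ} (A : Fin n → Finset ℤ) (G : List ℤ → ℝ) :
    expect (List.ofFn A) G =
      ∑ x ∈ Fintype.piFinset A, (∏ i, ((A i).card : ℝ)⁻¹) * G (List.ofFn x) := by
  induction n generalizing G with
  | zero => simp [expect]
  | succ n ih =>
    rw [List.ofFn_succ, expect, mean, div_eq_inv_mul, Finset.mul_sum]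
    simp only [ih, Finset.mul_sum]
    rw [← Finset.sum_product']
    refine Finset.sum_nbij' (fun u => Fin.cons u.1 u.2) (fun x => (x 0, fun i => x i.succ))
      ?_ ?_ ?_ ?_ ?_
    · rintro ⟨a, y⟩ h
      rw [Finset.mem_product, Fintype.mem_piFinset] at h
      rw [Fintype.mem_piFinset]
      intro i
      refine Fin.cases ?_ (fun i => ?_) i
      · exact h.1
      · exact h.2 i
    · intro x h
      rw [Fintype.mem_piFinset] at h
      rw [Finset.mem_product, Fintype.mem_piFinset]
      exact ⟨h 0, fun i => h i.succ⟩
    · rintro ⟨a, y⟩ _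
      simp
    · intro x _
      exact Fin.cons_self_tail x
    · rintro ⟨a, y⟩ _
      simp only [Fin.prod_univ_succ, List.ofFn_succ, Fin.cons_zero, Fin.cons_succ]
      ring

/-- Probabilities of events in terms of the `X i` are bounded by finite averages. The sample points
at which some `X i` lies outside `A i` form a null set. -/
theorem measureReal_le_expect {n : ℕ} {A : Fin n → Finset ℤ}
    {Ω : Type*} [MeasurableSpace Ω] {P : Measure Ω} [IsProbabilityMeasure P] {X : Fin n → Ω → ℤ}
    (hX : iIndepFun X P) (hlaw : ∀ i, HasLaw (X i) (uniformOn (A i : Set ℤ)) P)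
    (S : List ℤ → Prop) [DecidablePred S] :
    P.real {ω | S (List.ofFn fun i => X i ω)} ≤
      expect (List.ofFn A) fun xs => if S xs then 1 else 0 := by
  classical
  have hnull : ∀ i, P.real {ω | X i ω ∉ A i} = 0 := by
    intro i
    rw [(hlaw i).measureReal_eq (p := fun z => z ∉ A i) (MeasurableSet.of_discrete),
      measureReal_def,
      (uniformOn_eq_zero_iff (A i).finite_toSet).2, ENNReal.toReal_zero]
    ext z
    simp
  have hpt : ∀ i, ∀ a ∈ A i, P.real {ω | X i ω = a} = ((A i).card : ℝ)⁻¹ := by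
    intro i a ha
    have : ({z | z = a} : Set ℤ) = ((({a} : Finset ℤ)) : Set ℤ) := by ext; simp
    rw [(hlaw i).measureReal_eq (p := fun z => z = a) (MeasurableSet.of_discrete), measureReal_def,
      this, uniformOn_apply_finset, Finset.inter_singleton_of_mem ha]
    simp
  have hprod : ∀ x ∈ Fintype.piFinset A,
      P.real {ω | ∀ i, X i ω = x i} = ∏ i, ((A i).card : ℝ)⁻¹ := by
    intro x hx
    rw [Fintype.mem_piFinset] at hx
    have h := hX.measure_inter_preimage_eq_mul Finset.univ (sets := fun i => {x i})
      fun i _ => MeasurableSet.of_discrete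
    have e : {ω | ∀ i, X i ω = x i} = ⋂ i ∈ Finset.univ, X i ⁻¹' {x i} := by
      ext ω; simp
    rw [measureReal_def, e, h, ENNReal.toReal_prod]
    exact Finset.prod_congr rfl fun i _ => hpt i (x i) (hx i)
  have hsub : {ω | S (List.ofFn fun i => X i ω)} ⊆
      (⋃ i ∈ Finset.univ, {ω | X i ω ∉ A i}) ∪
        ⋃ x ∈ (Fintype.piFinset A).filter fun x => S (List.ofFn x), {ω | ∀ i, X i ω = x i} := by
    intro ω hω
    by_cases h : ∀ i, X i ω ∈ A i
    · refine Or.inr (Set.mem_biUnion (x := fun i => X i ω) ?_ fun i => rfl)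
      exact Finset.mem_coe.2 (Finset.mem_filter.2 ⟨Fintype.mem_piFinset.2 h, hω⟩)
    · push Not at h
      obtain ⟨i, hi⟩ := h
      exact Or.inl (Set.mem_biUnion (x := i) (by simp) hi)
  calc P.real {ω | S (List.ofFn fun i => X i ω)}
      ≤ P.real (⋃ i ∈ Finset.univ, {ω | X i ω ∉ A i}) + P.real
        (⋃ x ∈ (Fintype.piFinset A).filter fun x => S (List.ofFn x), {ω | ∀ i, X i ω = x i}) :=
        (measureReal_mono hsub).trans (measureReal_union_le _ _)
    _ ≤ ∑ i, P.real {ω | X i ω ∉ A i} +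
        ∑ x ∈ (Fintype.piFinset A).filter fun x => S (List.ofFn x),
          P.real {ω | ∀ i, X i ω = x i} :=
        add_le_add (measureReal_biUnion_finset_le _ _) (measureReal_biUnion_finset_le _ _)
    _ = expect (List.ofFn A) fun xs => if S xs then 1 else 0 := by
        rw [Finset.sum_eq_zero fun i _ => hnull i, zero_add, Finset.sum_filter, expect_ofFn]
        refine Finset.sum_congr rfl fun x hx => ?_
        rw [hprod x hx]
        simp

theorem measureReal_supNorm_le {n : ℕ} {A : Fin n → Finset ℤ}
    {Ω : Type*} [MeasurableSpace Ω] {P : Measure Ω} [IsProbabilityMeasure P] {X : Fin n → Ω → ℤ}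
    (hX : iIndepFun X P) (hlaw : ∀ i, HasLaw (X i) (uniformOn (A i : Set ℤ)) P)
    (p θ : ℝ) (f : ℤ → ℝ) :
    P.real {ω | θ < supNorm (bernoulliAverage f p fun i => X i ω)} ≤
      expectAvg p (List.ofFn A) (supIndicator θ) f := by
  classical
  have := measureReal_le_expect hX hlaw fun xs => θ < supNorm (avg p xs f)
  simp only [avg_ofFn] at this
  refine this.trans (expect_mono fun xs _ => ?_)
  simp only [supIndicator]
  split_ifs <;> simp

/-! ### Combining the reductions -/

theorem Log2IsLipschitz.le_two_mul {η : ℝ} {f : ℤ → ℝ} (hf : Log2IsLipschitz η f) {H : ℕ}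
    (hη0 : 0 ≤ η) (hη : η * H ≤ 1) {t t' : ℤ} (h : |t - t'| ≤ (H : ℤ)) : f t' ≤ 2 * f t := by
  obtain ⟨hpos, hlip⟩ := hf
  have key : ∀ (k : ℕ) (s : ℤ),
      |Real.logb 2 (f s) - Real.logb 2 (f (s + k))| ≤ η * k := by
    intro k s
    induction k with
    | zero => simp
    | succ k ih =>
      have h1 := hlip (s + k)
      have h2 := abs_sub_le (Real.logb 2 (f s)) (Real.logb 2 (f (s + k)))
        (Real.logb 2 (f (s + (k + 1 : ℕ))))
      push_cast at h2 ⊢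
      rw [← add_assoc] at h2 ⊢
      simp only at h1
      linarith
  have hle : Real.logb 2 (f t') ≤ Real.logb 2 (f t) + 1 := by
    have hk : ∀ k : ℕ, k ≤ H → η * k ≤ 1 := fun k hk => by
      have : (k : ℝ) ≤ H := by exact_mod_cast hk
      nlinarith
    rcases le_total t t' with htt | htt
    · have h1 := key (t' - t).toNat t
      rw [show t + ((t' - t).toNat : ℤ) = t' by omega] at h1
      have h2 := hk (t' - t).toNat (by have := abs_le.1 h; omega)
      linarith [(abs_le.1 h1).1]
    · have h1 := key (t - t').toNat t'
      rw [show t' + ((t - t').toNat : ℤ) = t by omega] at h1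
      have h2 := hk (t - t').toNat (by have := abs_le.1 h; omega)
      linarith [(abs_le.1 h1).2]
  have h2 : Real.logb 2 (f t) + 1 = Real.logb 2 (2 * f t) := by
    rw [Real.logb_mul (by norm_num) (hpos t).ne', Real.logb_self_eq_one (by norm_num), add_comm]
  rw [h2] at hle
  exact (Real.logb_le_logb (by norm_num) (hpos t') (by linarith [hpos t])).1 hle

/-- On windows below the scale of near constancy, window masses control the values. -/
theorem Spread.mul_le_of_le {N H : ℕ} {μ : ℝ} {f : ℤ → ℝ} (hf : Spread N H μ f) (hNH : N ≤ H)
    (t : ℤ) : N * f t ≤ 2 * μ := by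
  have h : ∑ _j ∈ Finset.range N, f t / 2 ≤ ∑ j ∈ Finset.range N, f (t + j) := by
    refine Finset.sum_le_sum fun j hj => ?_
    have := hf.le_two_mul (t + j) t (by
      rw [add_sub_cancel_left, abs_of_nonneg (Int.natCast_nonneg j)]
      have := Finset.mem_range.1 hj
      omega)
    linarith
  rw [Finset.sum_const, nsmul_eq_mul, Finset.card_range] at h
  linarith [hf.window_le t]

theorem Spread.supIndicator_eq_zero {N H : ℕ} {μ θ : ℝ} {f : ℤ → ℝ} (hf : Spread N H μ f)
    (hNH : N ≤ H) (hμ : 2 * μ ≤ N * θ) (hN : 1 ≤ N) : supIndicator θ f = 0 := by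
  unfold supIndicator
  rw [if_neg]
  intro h
  obtain ⟨t, ht⟩ := exists_lt_of_lt_supNorm hf.nonneg h
  have := hf.mul_le_of_le hNH t
  have hN0 : (0 : ℝ) < N := by exact_mod_cast hN
  nlinarith [mul_lt_mul_of_pos_left ht hN0]

/-- Averaging over increments of modulus at least `N` turns a density that is nearly constant
on the scale `H` into a spread-out one. -/
theorem spread_avg {N H : ℕ} {p : ℝ} (hp : 0 ≤ p) (hp2 : p ≤ 1 / 2) {f : ℤ → ℝ}
    (hf0 : ∀ t, 0 ≤ f t) (hf : HasSum f 1) (hlip : ∀ t t', |t - t'| ≤ (H : ℤ) → f t' ≤ 2 * f t)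
    {xs : List ℤ} (hx : ∀ x ∈ xs, (N : ℤ) ≤ |x|) {μ : ℝ} (hμ : 1 / √(1 + p * xs.length) ≤ μ) :
    Spread N H μ (avg p xs f) where
  nonneg := le_avg hp (by linarith) xs hf0
  hasSum := hasSum_avg hf
  le_two_mul := avg_le_two_mul hp (by linarith) xs hlip
  window_le t := (sum_range_avg_le hp hp2 hx hf0 hf t).trans hμ

/-- For an admissible family, the random increments may be replaced by three groups: `m₀`
increments of modulus at least `N`, a list `Q` of uniform increments on intervals, and `m` close
pairs of such increments. -/
theorem IsAdmissible.exists_groups {N n m₀ m : ℕ} {K δ : ℝ} {A : Fin n → Finset ℤ}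
    (hA : IsAdmissible N n K δ A) (hN : 1 ≤ N) (hm₀ : (m₀ : ℝ) ≤ δ * n)
    (hm : n / 8 + 2 + 2 * m + m₀ ≤ n) (p : ℝ) (Φ : (ℤ → ℝ) → ℝ) (f : ℤ → ℝ) :
    ∃ (Q₀ Q : List (ℤ × ℕ)) (P : List ((ℤ × ℕ) × (ℤ × ℕ))),
      expectAvg p (List.ofFn A) Φ f ≤
        expectAvg p (Q₀.map piece ++ (Q.map piece ++ flatPairs P)) Φ f ∧
      Q₀.length = m₀ ∧ P.length = m ∧ m₀ + Q.length + 2 * m = n ∧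
      (∀ q ∈ Q₀, 1 ≤ q.2 ∧ ∀ x ∈ piece q, (N : ℤ) ≤ |x|) ∧
      (∀ q ∈ Q, N ≤ q.2 ∧ q.2 ≤ 2 * N) ∧ ∀ u ∈ P, IsClosePair N u := by
  obtain ⟨T, hT, hle⟩ := exists_pieces p
    (good := fun B q => (N ≤ q.2 ∧ q.2 ≤ 2 * N) ∧ piece q ⊆ B) (L := List.ofFn A)
    (fun B hB F => by
      obtain ⟨i, rfl⟩ := (List.mem_ofFn' A B).1 hB
      obtain ⟨q, h1, h2, h3⟩ := hA.exists_piece hN i F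
      exact ⟨q, ⟨h1, h2⟩, h3⟩) Φ f
  have hTn : T.length = n := by simpa using hT.length_eq.symm
  have hgood : ∀ (i : ℕ) (hi : i < n) (hi' : i < T.length),
      (N ≤ T[i].2 ∧ T[i].2 ≤ 2 * N) ∧ piece T[i] ⊆ A ⟨i, hi⟩ := by
    intro i hi hi'
    have := (List.forall₂_iff_get.1 hT).2 i (by simpa using hi) hi'
    simpa using this
  have hall : ∀ q ∈ T, (N ≤ q.2 ∧ q.2 ≤ 2 * N) ∧ |q.1| ≤ (n : ℤ) * N := by
    intro q hq
    obtain ⟨i, hi, rfl⟩ := List.mem_iff_getElem.1 hq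
    have h := hgood i (by omega) hi
    refine ⟨h.1, ?_⟩
    have hmem : T[i].1 ∈ A ⟨i, by omega⟩ := h.2 (by
      rw [piece, Finset.mem_Ico]; omega)
    have h1 := hA.max_lt _ _ hmem
    have h2 := hA.max_lt _ _ (hA.symm _ _ hmem)
    rw [abs_le]
    constructor <;> linarith
  obtain ⟨P, Q, hperm, hPm, hP, hQ, hlen⟩ := exists_closePairs (n := n) (m := m) hN
    (Q := T.drop m₀) (fun q hq => (hall q (List.mem_of_mem_drop hq)).1)
    (fun q hq => (hall q (List.mem_of_mem_drop hq)).2)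
    (by rw [List.length_drop, hTn]; omega)
  rw [List.length_drop, hTn] at hlen
  refine ⟨T.take m₀, Q, P, ?_, ?_, hPm, by omega, ?_, hQ, hP⟩
  · refine hle.trans_eq (expectAvg_perm p ?_ Φ f)
    conv_lhs => rw [← List.take_append_drop m₀ T, List.map_append]
    exact List.Perm.append_left _ hperm
  · rw [List.length_take, hTn]; omega
  · intro q hq
    obtain ⟨i, hi, rfl⟩ := List.mem_take_iff_getElem.1 hq
    have hi' : i < m₀ ∧ i < T.length := by omega
    have h := hgood i (by omega) hi'.2
    refine ⟨by omega, fun x hx => ?_⟩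
    have hiδ : ((i : ℝ) + 1) ≤ δ * n := by
      have : (i : ℝ) + 1 ≤ m₀ := by exact_mod_cast hi'.1
      linarith
    have hd := Finset.disjoint_left.1 (hA.disjoint ⟨i, by omega⟩ hiδ) (h.2 hx)
    rw [Finset.mem_Icc] at hd
    rcases le_total 0 x with h0 | h0
    · rw [abs_of_nonneg h0]; omega
    · rw [abs_of_nonpos h0]; omega

/-! ### Choice of the parameters -/

open Filter Topology in
/-- Suitable parameters exist: since the factor `(1 - τ / 30) ^ j` beats `j`, a large `j` works, and
then a scale `H` that is large in terms of `j`. -/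
theorem exists_blockParams {τ : ℝ} (hτ : 0 < τ) (hτ1 : τ ≤ 1) : ∃ j H : ℕ, BlockParams j H τ := by
  have h := (tendsto_self_mul_const_pow_of_lt_one (r := 1 - τ / 30) (by linarith)
    (by linarith)).const_mul 74
  rw [mul_zero] at h
  obtain ⟨j, hj, hj1⟩ := ((h.eventually_le_const hτ).and (eventually_ge_atTop 1)).exists
  obtain ⟨H, hH⟩ := exists_nat_ge ((72 * (j : ℝ) + 3) * 2 ^ (2 * j) / (τ / 30 * τ))
  refine ⟨j, H, hj1, hτ, hτ1, by rw [mul_assoc]; exact hj, ?_⟩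
  rw [div_le_iff₀ (by positivity)] at hH
  linarith

theorem blockFactor_le {p τ : ℝ} {j q : ℕ} (hj : 1 ≤ j) (hτ : 0 ≤ τ)
    (hq : (1 - p ^ (2 * (2 * j)) / 2) ^ q ≤ (4 * τ) ^ j) :
    blockFactor p τ j q ≤ (128 * τ) ^ j := by
  have h2 : (2 : ℝ) ≤ 2 ^ j := by
    calc (2 : ℝ) = 2 ^ 1 := by norm_num
      _ ≤ 2 ^ j := pow_le_pow_right₀ (by norm_num) hj
  calc blockFactor p τ j q ≤ 4 ^ (2 * j) * ((4 * τ) ^ j + (4 * τ) ^ j) := by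
        unfold blockFactor
        gcongr
    _ = 2 * (64 * τ) ^ j := by
        rw [pow_mul, show (64 : ℝ) * τ = 4 ^ 2 * (4 * τ) by ring, mul_pow (4 ^ 2)]
        ring
    _ ≤ 2 ^ j * (64 * τ) ^ j := by gcongr
    _ = (128 * τ) ^ j := by rw [← mul_pow]; ring

/-- The final numerical estimate: `X = N √n` is the inverse of the target level. -/
theorem deviation_bound {q B n n₁ : ℕ} {X L R γ ρ ω M : ℝ} (hX : 1 ≤ X) (hL : 1 ≤ L)
    (hR : 0 < R) (hγ0 : 0 ≤ γ) (hM : 1 ≤ M) (hn : 1 ≤ n) (hn₁ : n₁ ≤ n) (hρ : 0 ≤ ρ) (hω : 0 ≤ ω)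
    (hXn : X ≤ Real.exp (2 * n)) (hRn : R ^ q ≤ Real.exp n)
    (hγ : γ ^ B ≤ Real.exp (-(M + 4) * n)) (hXρ : X * ρ ^ n₁ ≤ ω ^ n)
    (hωq : 4 * ω ^ (q + 1) ≤ Real.exp (-(M + 1))) :
    ((L / X) ^ (q + 1))⁻¹ * (γ ^ B * ((R / X) ^ q + (4 * ρ ^ (q + 1)) ^ n₁)) ≤
      Real.exp (-M * n) := by
  have hX0 : 0 < X := by linarith
  have hn0 : (1 : ℝ) ≤ n := by exact_mod_cast hn
  have hγ1 : γ ^ B ≤ 1 := hγ.trans (Real.exp_le_one_iff.2 (by nlinarith))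
  have hinv : ((L / X) ^ (q + 1))⁻¹ ≤ X ^ (q + 1) := by
    rw [← inv_pow, inv_div]
    gcongr
    exact div_le_self hX0.le hL
  have hA : X ^ (q + 1) * (γ ^ B * (R / X) ^ q) ≤ Real.exp (-(M + 1) * n) := by
    calc X ^ (q + 1) * (γ ^ B * (R / X) ^ q) = X * R ^ q * γ ^ B := by
          rw [div_pow, pow_succ]; field_simp
      _ ≤ Real.exp (2 * n) * Real.exp n * Real.exp (-(M + 4) * n) := by gcongr
      _ = Real.exp (-(M + 1) * n) := by
          rw [← Real.exp_add, ← Real.exp_add]; congr 1; ring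
  have hB : X ^ (q + 1) * (γ ^ B * (4 * ρ ^ (q + 1)) ^ n₁) ≤ Real.exp (-(M + 1) * n) := by
    have h4 : (4 : ℝ) ^ n₁ ≤ 4 ^ n := pow_le_pow_right₀ (by norm_num) hn₁
    calc X ^ (q + 1) * (γ ^ B * (4 * ρ ^ (q + 1)) ^ n₁)
        ≤ X ^ (q + 1) * (1 * (4 * ρ ^ (q + 1)) ^ n₁) := by gcongr
      _ = 4 ^ n₁ * (X * ρ ^ n₁) ^ (q + 1) := by
          rw [one_mul, mul_pow, mul_pow, ← pow_mul, ← pow_mul, mul_comm n₁]; ring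
      _ ≤ 4 ^ n * (ω ^ n) ^ (q + 1) := by gcongr
      _ = (4 * ω ^ (q + 1)) ^ n := by rw [mul_pow, ← pow_mul, ← pow_mul, mul_comm n]
      _ ≤ Real.exp (-(M + 1)) ^ n := by gcongr
      _ = Real.exp (-(M + 1) * n) := by rw [← Real.exp_nat_mul]; congr 1; ring
  have h2 : (2 : ℝ) ≤ Real.exp n := by
    have := Real.add_one_le_exp (n : ℝ)
    linarith
  calc _ ≤ X ^ (q + 1) * (γ ^ B * ((R / X) ^ q + (4 * ρ ^ (q + 1)) ^ n₁)) := by gcongr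
    _ = X ^ (q + 1) * (γ ^ B * (R / X) ^ q) + X ^ (q + 1) * (γ ^ B * (4 * ρ ^ (q + 1)) ^ n₁) := by
        ring
    _ ≤ 2 * Real.exp (-(M + 1) * n) := by linarith
    _ ≤ Real.exp n * Real.exp (-(M + 1) * n) := by gcongr
    _ = Real.exp (-M * n) := by rw [← Real.exp_add]; congr 1; ring

/-- A small proportion `3 κ` of the increments can be set aside without affecting the exponential
decay. -/
theorem exists_proportion {ρ a : ℝ} (hρ : 0 < ρ) (hρa : ρ < a) :
    ∃ κ ν : ℝ, 0 < κ ∧ κ ≤ 1 / 16 ∧ 0 < ν ∧ ν < 1 ∧ ρ * 2 ^ (3 * κ) ≤ ν * a := by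
  have ha : 0 < a := hρ.trans hρa
  have hν0 : 0 < √(ρ / a) := Real.sqrt_pos.2 (by positivity)
  have hν1 : √(ρ / a) < 1 := by
    rw [Real.sqrt_lt' one_pos, one_pow, div_lt_one ha]
    exact hρa
  set ν := √(ρ / a) with hν
  have hsq : ρ = ν * ν * a := by
    rw [hν, Real.mul_self_sqrt (by positivity)]; field_simp
  have hlog : 0 < -Real.log ν := neg_pos.2 (Real.log_neg hν0 hν1)
  have hlog2 : 0 < Real.log 2 := Real.log_pos (by norm_num)
  refine ⟨min (1 / 16) (-Real.log ν / (3 * Real.log 2)), ν,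
    lt_min (by norm_num) (by positivity), min_le_left _ _, hν0, hν1, ?_⟩
  set κ := min (1 / 16) (-Real.log ν / (3 * Real.log 2))
  have hκ : κ ≤ -Real.log ν / (3 * Real.log 2) := min_le_right _ _
  rw [le_div_iff₀ (by positivity)] at hκ
  have h2 : (2 : ℝ) ^ (3 * κ) ≤ ν⁻¹ := by
    rw [Real.rpow_def_of_pos (by norm_num), ← Real.exp_log (inv_pos.2 hν0), Real.log_inv]
    exact Real.exp_le_exp.2 (by linarith)
  calc ρ * 2 ^ (3 * κ) ≤ ρ * ν⁻¹ := by gcongr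
    _ = ν * a := by rw [hsq]; field_simp

/-- After `n₁ ≥ (1 - 3 κ) n` steps with contraction factor `ρ`, the initial size `N √n` has been
beaten by an exponential factor. -/
theorem mul_pow_le_of_proportion {N n n₁ : ℕ} {ρ a κ ν : ℝ} (hρ : 1 / 2 ≤ ρ) (ha : 0 < a)
    (hν : 0 < ν) (hκ : ρ * 2 ^ (3 * κ) ≤ ν * a) (hN : (N : ℝ) ≤ a ^ (-(n : ℤ)))
    (hn₁ : n₁ ≤ n) (hn₁' : (n : ℝ) - n₁ ≤ 3 * κ * n) (hn : n * √ν ^ n ≤ 1) :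
    N * √n * ρ ^ n₁ ≤ √ν ^ n := by
  have hρ0 : 0 < ρ := by linarith
  have h1 : ρ ^ n₁ ≤ ρ ^ n * 2 ^ (n - n₁) := by
    have : 1 ≤ (ρ * 2) ^ (n - n₁) := one_le_pow₀ (by linarith)
    calc ρ ^ n₁ ≤ ρ ^ n₁ * (ρ * 2) ^ (n - n₁) := le_mul_of_one_le_right (by positivity) this
      _ = ρ ^ n * 2 ^ (n - n₁) := by
          rw [mul_pow, ← mul_assoc, ← pow_add, Nat.add_sub_cancel' hn₁]
  have h2 : (2 : ℝ) ^ (n - n₁) ≤ (2 ^ (3 * κ)) ^ n := by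
    rw [← Real.rpow_natCast, ← Real.rpow_natCast, ← Real.rpow_mul (by norm_num), Nat.cast_sub hn₁]
    exact Real.rpow_le_rpow_of_exponent_le (by norm_num) hn₁'
  have h3 : ρ ^ n₁ ≤ ν ^ n * a ^ n := by
    calc ρ ^ n₁ ≤ ρ ^ n * (2 ^ (3 * κ)) ^ n := h1.trans (by gcongr)
      _ = (ρ * 2 ^ (3 * κ)) ^ n := by rw [mul_pow]
      _ ≤ (ν * a) ^ n := by gcongr
      _ = _ := mul_pow _ _ _
  have hsqrt : √(n : ℝ) ≤ n := by
    rw [Real.sqrt_le_left (Nat.cast_nonneg n)]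
    exact_mod_cast Nat.le_self_pow two_ne_zero n
  rw [zpow_neg, zpow_natCast] at hN
  calc N * √n * ρ ^ n₁ ≤ (a ^ n)⁻¹ * n * (ν ^ n * a ^ n) := by gcongr
    _ = (n * √ν ^ n) * √ν ^ n := by
        have : ν ^ n = √ν ^ n * √ν ^ n := by rw [← mul_pow, Real.mul_self_sqrt hν.le]
        rw [this]; field_simp
    _ ≤ 1 * √ν ^ n := by gcongr
    _ = √ν ^ n := one_mul _

/-- For given parameters, the deviation probability is bounded in terms of the number `B` of blocks
of pairs and the number `n₁` of increments that are averaged one by one. The constant `√(p κ δ)`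
comes from the window bound for the first `κ δ n` increments. -/
theorem exists_measureReal_le {N n j H q : ℕ} {K δ p κ r τ : ℝ} {A : Fin n → Finset ℤ}
    (hA : IsAdmissible N n K δ A) (hδ : 0 < δ) (hδ1 : δ ≤ 1) (hp : 0 < p) (hp2 : p ≤ 1 / 2)
    (hκ : 0 < κ) (hκ16 : κ ≤ 1 / 16) (hr : 0 < r) (hr1 : r ≤ 1) (hj : BlockParams j H τ)
    {L R : ℝ} (hL : L = 16 / √(p * κ * δ)) (hR : R = L / (8 * r * (1 - p + p * r) ^ (q + 1)))
    (hN : 1 ≤ N) (hn16 : 16 ≤ n) (hjn : 2 * j ≤ κ * n) {f : ℤ → ℝ} (hf0 : ∀ t, 0 ≤ f t)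
    (hf : HasSum f 1) (hf2 : ∀ t t', |t - t'| ≤ (H : ℤ) → f t' ≤ 2 * f t)
    {Ω : Type*} [MeasurableSpace Ω] {P : Measure Ω} [IsProbabilityMeasure P] {X : Fin n → Ω → ℤ}
    (hX : iIndepFun X P) (hlaw : ∀ i, HasLaw (X i) (uniformOn (A i : Set ℤ)) P) :
    ∃ B n₁ : ℕ, κ * n ≤ 4 * (j * B) ∧ n₁ ≤ n ∧ (n : ℝ) - n₁ ≤ 3 * κ * n ∧
      P.real {ω | L / (N * √n) < supNorm (bernoulliAverage f p fun i => X i ω)} ≤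
        ((L / (N * √n)) ^ (q + 1))⁻¹ * (blockFactor p τ j (q + 1) ^ B *
          ((R / (N * √n)) ^ q + (4 * (1 - p + p * r) ^ (q + 1)) ^ n₁)) := by
  have hnR : (16 : ℝ) ≤ n := by exact_mod_cast hn16
  have hN1 : (1 : ℝ) ≤ N := by exact_mod_cast hN
  have hp0 := hp.le
  have hp1 : p ≤ 1 := by linarith
  have hjpos := hj.j_pos
  set ρ := 1 - p + p * r with hρ_def
  have hρ : 0 < ρ := by
    have := mul_pos hp hr
    linarith
  set c := √(p * κ * δ) with hc_def
  have hc0 : 0 < c := Real.sqrt_pos.2 (by positivity)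
  have hL0 : 0 < L := by rw [hL]; positivity
  have hR0 : 0 < R := by rw [hR]; positivity
  have hsqrtn : 0 < √(n : ℝ) := Real.sqrt_pos.2 (by linarith)
  have hκn0 : 0 < κ * n := by positivity
  -- the numbers `m₀` of large increments and `B` of blocks of `2 j` pairs
  set m₀ := ⌊κ * δ * n⌋₊ with hm₀_def
  set B := ⌊κ * n / (2 * j)⌋₊ with hB_def
  have hjR : (1 : ℝ) ≤ j := by exact_mod_cast hjpos
  have hm₀ : (m₀ : ℝ) ≤ κ * δ * n := Nat.floor_le (by positivity)
  have hm₀' : κ * δ * n < m₀ + 1 := Nat.lt_floor_add_one _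
  have hB : (B : ℝ) * (2 * j) ≤ κ * n :=
    (le_div_iff₀ (by positivity)).1 (Nat.floor_le (by positivity))
  have hB' : κ * n ≤ 4 * (j * B) := by
    have h1 : κ * n < (B + 1) * (2 * j) :=
      (div_lt_iff₀ (by positivity)).1 (Nat.lt_floor_add_one _)
    have h2 : (1 : ℝ) ≤ B := by
      have : 1 ≤ B := Nat.le_floor (by
        rw [Nat.cast_one, one_le_div (by positivity)]
        exact hjn)
      exact_mod_cast this
    have h3 : (j : ℝ) ≤ j * B := le_mul_of_one_le_right (by positivity) h2
    have h4 : ((B : ℝ) + 1) * (2 * j) = 2 * (j * B) + 2 * j := by ring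
    linarith
  have hκn : κ * n ≤ n / 16 := by
    have := mul_le_mul_of_nonneg_right hκ16 (by linarith : (0 : ℝ) ≤ n)
    linarith
  have hδn : κ * δ * n ≤ κ * n := by
    have := mul_le_mul_of_nonneg_left hδ1 hκn0.le
    linarith
  have hm₀δ : (m₀ : ℝ) ≤ δ * n := by
    have : κ * (δ * n) ≤ 1 * (δ * n) := by gcongr; linarith
    linarith
  have hcount : n / 8 + 2 + 2 * (B * (2 * j)) + m₀ ≤ n := by
    have h1 : 16 * (B * (2 * j)) ≤ n := by
      have : 16 * ((B : ℝ) * (2 * j)) ≤ n := by linarith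
      exact_mod_cast this
    have h2 : 16 * m₀ ≤ n := by
      have : 16 * (m₀ : ℝ) ≤ n := by linarith
      exact_mod_cast this
    omega
  obtain ⟨Q₀, Q, PP, hle, hQ₀n, hPn, hQn, hQ₀, hQ, hPP⟩ := hA.exists_groups (m₀ := m₀)
    (m := B * (2 * j)) hN hm₀δ hcount p (supIndicator (L / (N * √n))) f
  refine ⟨B, Q.length, hB', by omega, ?_, ?_⟩
  · have h1 : (m₀ : ℝ) + Q.length + 2 * (B * (2 * j)) = n := by exact_mod_cast hQn
    linarith
  refine (measureReal_supNorm_le hX hlaw p _ f).trans (hle.trans ?_)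
  rw [expectAvg_append]
  -- the first group of increments is fixed: the window bound holds for all of their values
  refine expect_le_of_le (fun B hB => by
    obtain ⟨q, hq, rfl⟩ := List.mem_map.1 hB
    exact Finset.card_pos.1 (by rw [card_piece]; exact (hQ₀ q hq).1)) fun xs hxs => ?_
  have hxlen : xs.length = m₀ := by rw [hxs.length_eq, List.length_map, hQ₀n]
  have hxN : ∀ x ∈ xs, (N : ℤ) ≤ |x| := by
    intro x hx
    obtain ⟨i, hi, rfl⟩ := List.mem_iff_getElem.1 hx
    have := (List.forall₂_iff_get.1 hxs).2 i hi (by rw [← hxs.length_eq]; exact hi)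
    simp only [List.get_eq_getElem, List.getElem_map] at this
    exact (hQ₀ _ (List.getElem_mem _)).2 _ this
  set μ := L / (16 * √n) with hμ_def
  have hspread : Spread N H μ (avg p xs f) := by
    refine spread_avg hp0 hp2 hf0 hf hf2 hxN ?_
    rw [hxlen, hμ_def, hL, div_div, mul_comm c, mul_assoc,
      ← div_div, div_self (by norm_num : (16 : ℝ) ≠ 0), hc_def, ← Real.sqrt_mul (by positivity)]
    refine one_div_le_one_div_of_le (Real.sqrt_pos.2 (by positivity)) (Real.sqrt_le_sqrt ?_)
    have h1 : p * (κ * δ * n) ≤ p * (m₀ + 1) := by gcongr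
    linarith
  have hμθ : 16 * μ = N * (L / (N * √n)) := by rw [hμ_def]; field_simp
  have hμ0 : 0 < μ := by positivity
  rcases le_or_gt N H with hNH | hNH
  · have hzero : ∀ ys, supIndicator (L / (N * √n)) (avg p ys (avg p xs f)) = 0 := fun ys =>
      (hspread.avg hp0 hp1 ys).supIndicator_eq_zero hNH (by linarith) hN
    have hzero' : expect (Q.map piece ++ flatPairs PP) (fun _ => 0) = 0 := by
      simpa only [zero_mul, mul_zero] using
        expect_const_mul (Q.map piece ++ flatPairs PP) 0 fun _ => 0
    simp only [expectAvg, hzero]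
    rw [hzero']
    have := blockFactor_nonneg hp0 hp1 hj.pos.le j (q + 1)
    positivity
  · refine expectAvg_supIndicator_le hp0 hp2 hj hNH.le hspread (by positivity) hμθ.le hr hr1
      (by positivity) (by positivity) ?_ hQ hPP hPn
    have e : 2 * μ / (N * (r * (R / (N * √n)))) = ρ ^ (q + 1) := by
      rw [hμ_def, hR]
      field_simp
      norm_num
    rw [e]
    linarith

end RandomAveraging

open RandomAveraging Filter Topology in
theorem mainTheorem2 (δ p ε K : ℝ) (hδ : 0 < δ) (hδ1 : δ ≤ 1) (hp : 0 < p) (hp2 : p ≤ 1 / 2)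
    (hε : 0 < ε) (hεp : ε < p) (hK : 1 ≤ K) :
    ∃ L : ℝ, 0 < L ∧
      ∀ M : ℝ, 1 ≤ M →
        ∃ n₀ : ℕ, 1 ≤ n₀ ∧ ∃ η : ℝ, 0 < η ∧ η ≤ 1 ∧
          ∀ n : ℕ, n₀ ≤ n →
          ∀ N : ℕ, 1 ≤ N → (N : ℝ) ≤ (1 - p + ε) ^ (-(n : ℤ)) →
          ∀ A : Fin n → Finset ℤ, RandomAveraging.IsAdmissible N n K δ A →
          ∀ f : ℤ → ℝ, (∀ t, 0 ≤ f t) → HasSum (fun t => |f t|) 1 →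
            RandomAveraging.Log2IsLipschitz η f →
          ∀ (Ω : Type*) [MeasurableSpace Ω] (P : Measure Ω) [IsProbabilityMeasure P]
            (X : Fin n → Ω → ℤ),
            iIndepFun X P →
            (∀ i, HasLaw (X i) (uniformOn (A i : Set ℤ)) P) →
            P.real {ω | L * ((N : ℝ) * √(n : ℝ))⁻¹ <
                RandomAveraging.supNorm
                  (RandomAveraging.bernoulliAverage f p (fun i => X i ω))} ≤
              Real.exp (-M * n) := by
  have hp0 := hp.le
  have hp1 : p ≤ 1 := by linarith
  -- `a ^ (-n)` bounds `N`, and `ρ < a` is the contraction factor of a single increment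
  obtain ⟨a, ha_def⟩ : ∃ a, a = 1 - p + ε := ⟨_, rfl⟩
  obtain ⟨r, hr_def⟩ : ∃ r, r = ε / 2 := ⟨_, rfl⟩
  obtain ⟨ρ, hρ_def⟩ : ∃ ρ, ρ = 1 - p + p * r := ⟨_, rfl⟩
  have hr : 0 < r := by linarith
  have hr1 : r ≤ 1 := by linarith
  have hpr : p * r ≤ r := mul_le_of_le_one_left hr.le hp1
  have hρ2 : 1 / 2 ≤ ρ := by
    have := mul_pos hp hr
    linarith
  have hρa : ρ < a := by linarith
  have ha : 0 < a := by linarith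
  obtain ⟨κ, ν, hκ, hκ16, hν, hν1, hκν⟩ := exists_proportion (by linarith : 0 < ρ) hρa
  have hsqrtν0 : 0 ≤ √ν := Real.sqrt_nonneg _
  have hsqrtν1 : √ν < 1 := by rw [Real.sqrt_lt' one_pos, one_pow]; exact hν1
  have hc0 : 0 < √(p * κ * δ) := Real.sqrt_pos.2 (by positivity)
  have hc1 : √(p * κ * δ) ≤ 1 := Real.sqrt_le_one.2 (by
    have : p * κ ≤ 1 := mul_le_one₀ hp1 hκ.le (by linarith)
    exact mul_le_one₀ this hδ.le hδ1)
  obtain ⟨L, hL⟩ : ∃ L, L = 16 / √(p * κ * δ) := ⟨_, rfl⟩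
  have hL16 : 16 ≤ L := by rw [hL, le_div_iff₀ hc0]; linarith
  refine ⟨L, by linarith, fun M hM => ?_⟩
  -- the probability `τ` of a single increment, and the block size `j` and scale `H` it requires
  obtain ⟨τ, hτ_def⟩ : ∃ τ, τ = Real.exp (-(4 / κ * (M + 4))) / 128 := ⟨_, rfl⟩
  have hτ : 0 < τ := by rw [hτ_def]; positivity
  have hτ128 : 128 * τ = Real.exp (-(4 / κ * (M + 4))) := by rw [hτ_def]; ring
  have hτ1 : 128 * τ ≤ 1 := by
    rw [hτ128, Real.exp_le_one_iff, neg_nonpos]; positivity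
  obtain ⟨j, H, hj⟩ := exists_blockParams hτ (by linarith)
  have hjpos := hj.j_pos
  have hH1 : (1 : ℝ) ≤ H := by exact_mod_cast hj.one_le
  -- the exponent `q + 1` of the power sums
  obtain ⟨q, hq1, hq2⟩ : ∃ q : ℕ, 4 * √ν ^ (q + 1) ≤ Real.exp (-(M + 1)) ∧
      (1 - p ^ (2 * (2 * j)) / 2) ^ (q + 1) ≤ (4 * τ) ^ j := by
    have hpk : 0 < p ^ (2 * (2 * j)) := by positivity
    have hpk1 : p ^ (2 * (2 * j)) ≤ 1 := pow_le_one₀ hp0 hp1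
    have t1 := ((tendsto_pow_atTop_nhds_zero_of_lt_one hsqrtν0 hsqrtν1).comp
      (tendsto_add_atTop_nat 1)).const_mul 4
    have t2 := (tendsto_pow_atTop_nhds_zero_of_lt_one
      (by linarith : 0 ≤ 1 - p ^ (2 * (2 * j)) / 2) (by linarith)).comp (tendsto_add_atTop_nat 1)
    rw [mul_zero] at t1
    exact ((t1.eventually_le_const (Real.exp_pos _)).and
      (t2.eventually_le_const (by positivity))).exists
  -- the intermediate level `R / (N √n)`
  obtain ⟨R, hR_def⟩ : ∃ R, R = L / (8 * r * ρ ^ (q + 1)) := ⟨_, rfl⟩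
  have hR : 0 < R := by rw [hR_def]; positivity
  obtain ⟨n₀, hn₀⟩ : ∃ n₀ : ℕ, ∀ n : ℕ, n₀ ≤ n →
      (n * √ν ^ n ≤ 1 ∧ R ^ q ≤ Real.exp n) ∧ (2 * j ≤ κ * n ∧ 16 ≤ n) := by
    have t1 := tendsto_self_mul_const_pow_of_lt_one hsqrtν0 hsqrtν1
    have t2 := Real.tendsto_exp_atTop.comp (tendsto_natCast_atTop_atTop (R := ℝ))
    have t3 := (tendsto_natCast_atTop_atTop (R := ℝ)).const_mul_atTop hκ
    exact eventually_atTop.1 (((t1.eventually_le_const one_pos).and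
      (t2.eventually_ge_atTop (R ^ q))).and
      ((t3.eventually_ge_atTop _).and (eventually_ge_atTop 16)))
  refine ⟨max n₀ 1, le_max_right _ _, 1 / H, by positivity, (div_le_one (by positivity)).2 hH1, ?_⟩
  intro n hn N hN hNa A hA f hf0 hfsum hlip Ω _ P _ X hX hlaw
  rw [← ha_def] at hNa
  obtain ⟨⟨hnν, hRn⟩, hjn, hn16⟩ := hn₀ n ((le_max_left _ _).trans hn)
  have hnR : (16 : ℝ) ≤ n := by exact_mod_cast hn16
  have hN1 : (1 : ℝ) ≤ N := by exact_mod_cast hN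
  have hX1 : 1 ≤ (N : ℝ) * √n :=
    one_le_mul_of_one_le_of_one_le hN1 (Real.one_le_sqrt.2 (by linarith))
  have hf : HasSum f 1 := by simpa only [abs_of_nonneg (hf0 _)] using hfsum
  obtain ⟨B, n₁, hB, hn₁, hn₁', hP⟩ := exists_measureReal_le (q := q) (R := R) hA hδ hδ1 hp hp2 hκ
    hκ16 hr hr1 hj hL (by rw [hR_def, hρ_def]) hN hn16 hjn hf0 hf (fun t t' h =>
      hlip.le_two_mul (by positivity) (by rw [one_div, inv_mul_cancel₀ (by positivity)]) h) hX hlaw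
  rw [← hρ_def] at hP
  rw [← div_eq_mul_inv]
  refine hP.trans (deviation_bound hX1 (by linarith) hR (blockFactor_nonneg hp0 hp1 hτ.le j (q + 1))
    hM (by omega) hn₁ (by linarith) hsqrtν0 ?_ hRn ?_ ?_ hq1)
  · -- `N ≤ a ^ (-n) ≤ 2 ^ n ≤ exp n`
    have h1 : (N : ℝ) ≤ Real.exp n := by
      refine hNa.trans ?_
      rw [zpow_neg, zpow_natCast, ← inv_pow]
      calc a⁻¹ ^ n ≤ 2 ^ n := by
            gcongr
            rw [inv_le_comm₀ ha (by norm_num)]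
            linarith
        _ ≤ Real.exp 1 ^ n := by
            gcongr
            have := Real.add_one_le_exp (1 : ℝ)
            linarith
        _ = Real.exp n := by rw [← Real.exp_nat_mul, mul_one]
    have h2 : √(n : ℝ) ≤ Real.exp n := by
      have hsqrt : √(n : ℝ) ≤ n := by
        rw [Real.sqrt_le_left (Nat.cast_nonneg n)]
        exact_mod_cast Nat.le_self_pow two_ne_zero n
      have := Real.add_one_le_exp (n : ℝ)
      linarith
    calc (N : ℝ) * √n ≤ Real.exp n * Real.exp n := by gcongr
      _ = Real.exp (2 * n) := by rw [← Real.exp_add]; congr 1; ring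
  · calc blockFactor p τ j (q + 1) ^ B ≤ ((128 * τ) ^ j) ^ B := by
          gcongr
          · exact blockFactor_nonneg hp0 hp1 hτ.le j (q + 1)
          · exact blockFactor_le hjpos hτ.le hq2
      _ = Real.exp (-(4 / κ * (M + 4)) * (j * B)) := by
          rw [← pow_mul, hτ128, ← Real.exp_nat_mul]
          congr 1
          push_cast
          ring
      _ ≤ Real.exp (-(M + 4) * n) := by
          refine Real.exp_le_exp.2 ?_
          have : (M + 4) * n ≤ 4 / κ * (M + 4) * (j * B) := by
            calc (M + 4) * (n : ℝ) = (M + 4) / κ * (κ * n) := by field_simp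
              _ ≤ (M + 4) / κ * (4 * (j * B)) := by gcongr
              _ = _ := by ring
          linarith
  · exact mul_pow_le_of_proportion hρ2 ha hν hκν hNa hn₁ hn₁' hnν
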